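/- Let $d\ge 1$ and let $A$ be a $d\times d$ integral matrix with $|\det A|=2$ all of whose complex eigenvalues have modulus greater than $1$. Write $\vec x\circ\vec y=\sum_j x_jy_j$. Assume that $A\mathbb Z^d=A^{\tau}\mathbb Z^d$, where $A^\tau$ is the transpose of $A$, and that $\vec\ell_A,\vec q_A\in\mathbb Z^d$ are vectors such that $$\mathbb Z^d=(\vec\ell_A+A\mathbb Z^d)\,\dot\cup\,A\mathbb Z^d\ \text{ (disjoint union)},\qquad \vec q_A\circ A\mathbb Z^d\subseteq 2\mathbb Z,\qquad \vec q_A\circ(\vec\ell_A+A\mathbb Z^d)\subseteq 2\mathbb Z+1 .$$ Let $(h_{\vec n})_{\vec n\in\mathbb Z^d}$ be complex numbers, all but finitely many equal to $0$, with $$\sum_{\vec n\in\mathbb Z^d}h_{\vec n}\overline{h_{\vec n+\vec k}}=\delta_{\vec 0\,\vec k}\quad(\vec k\in A\mathbb Z^d),\qquad \sum_{\vec n\in\mathbb Z^d}h_{\vec n}=\sqrt2 .$$ Put $m_0(\vec t)=\frac1{\sqrt2}\sum_{\vec n\in\mathbb Z^d}h_{\vec n}e^{-i\vec n\circ\vec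 t}$ and $$g(\vec\xi)=\frac1{(2\pi)^{d/2}}\prod_{j=1}^{\infty}m_0\big((A^\tau)^{-j}\vec\xi\big),\qquad \vec\xi\in\mathbb R^d .$$ Then the product converges (unconditionally) for every $\vec\xi\in\mathbb R^d$ and $g\in L^2(\mathbb R^d)$. Let $\varphi=\mathcal F^{-1}g\in L^2(\mathbb R^d)$, where $\mathcal F$ is the unitary extension to $L^2(\mathbb R^d)$ of $(\mathcal Ff)(\vec s)=(2\pi)^{-d/2}\int_{\mathbb R^d}e^{-i\vec s\circ\vec t}f(\vec t)\,d\vec t$. On $L^2(\mathbb R^d)$ let $(T_{\vec\ell}f)(\vec t)=f(\vec t-\vec\ell)$ and $(D_Af)(\vec t)=\sqrt{|\det A|}\,f(A\vec t)$, and put $$\psi=\sum_{\vec n\in\mathbb Z^d}(-1)^{\vec q_A\circ\vec n}\,\overline{h_{\vec\ell_A-\vec n}}\,D_AT_{\vec n}\varphi .$$ Then $\{D_A^nT_{\vec\ell}\psi:\ n\in\mathbb Z,\ \vec\ell\in\mathbb Z^d\}$ is a Parseval's frame (normalized tight frame) of $L^2(\mathbb R^d)$, that is, $$\sum_{n\in\mathbb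 Z,\ \vec\ell\in\mathbb Z^d}|\langle f,D_A^nT_{\vec\ell}\psi\rangle|^2=\|f\|^2\qquad\text{for all } f\in L^2(\mathbb R^d).$$ -/

import Mathlib

open MeasureTheory

noncomputable section

namespace Wavelet

/-- The Hilbert space `L²(ℝ^d)` of square integrable complex valued functions. -/
abbrev L2 (d : ℕ) : Type := Lp (α := EuclideanSpace ℝ (Fin d)) ℂ 2

/-! ### Lattice vectors and matrices -/

/-- The inclusion `ℤ^d ⊆ ℝ^d`. -/
def latticePoint {d : ℕ} (n : Fin d → ℤ) : EuclideanSpace ℝ (Fin d) :=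
  WithLp.toLp 2 fun i => (n i : ℝ)

/-- An integral matrix regarded as a real matrix. -/
def realMat {d : ℕ} (A : Matrix (Fin d) (Fin d) ℤ) : Matrix (Fin d) (Fin d) ℝ :=
  A.map fun z => (z : ℝ)

/-- The subset `A ℤ^d` of `ℤ^d`. -/
def imageLattice {d : ℕ} (A : Matrix (Fin d) (Fin d) ℤ) : Set (Fin d → ℤ) :=
  Set.range fun k : Fin d → ℤ => A.mulVec k

/-- `A` is expansive: every (complex) eigenvalue of `A` has modulus greater than one. -/
def IsExpansive {d : ℕ} (A : Matrix (Fin d) (Fin d) ℤ) : Prop :=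
  ∀ β ∈ spectrum ℂ (A.map fun z => (z : ℂ)), 1 < ‖β‖

/-- The partition properties of an integral matrix `A` with vectors `ℓ, q ∈ ℤ^d`. -/
structure PartitionProperties {d : ℕ} (A : Matrix (Fin d) (Fin d) ℤ) (ℓ q : Fin d → ℤ) :
    Prop where
  /-- `A ℤ^d = A^τ ℤ^d` -/
  image_transpose : imageLattice A = imageLattice A.transpose
  /-- `ℤ^d = (ℓ + A ℤ^d) ∪ A ℤ^d` -/
  union_eq : (fun x => ℓ + x) '' imageLattice A ∪ imageLattice A = Set.univ
  /-- the above union is disjoint -/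
  disjoint : Disjoint ((fun x => ℓ + x) '' imageLattice A) (imageLattice A)
  /-- `q ∘ A ℤ^d ⊆ 2ℤ` -/
  even_dot : ∀ x ∈ imageLattice A, Even (q ⬝ᵥ x)
  /-- `q ∘ (ℓ + A ℤ^d) ⊆ 2ℤ + 1` -/
  odd_dot : ∀ x ∈ (fun x => ℓ + x) '' imageLattice A, Odd (q ⬝ᵥ x)

/-- `h` is a finite solution of Lawton's system of equations associated with `A`. -/
structure IsFiniteLawtonSolution {d : ℕ} (A : Matrix (Fin d) (Fin d) ℤ)
    (h : (Fin d → ℤ) → ℂ) : Prop where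
  finite_support : (Function.support h).Finite
  orthogonality : ∀ k ∈ imageLattice A,
    ∑ᶠ n, h n * (starRingEnd ℂ) (h (n + k)) = if k = 0 then 1 else 0
  normalization : ∑ᶠ n, h n = (Real.sqrt 2 : ℂ)

/-! ### Unitary operators on `L²(ℝ^d)` -/

theorem map_toEuclideanLin {d : ℕ} (M : Matrix (Fin d) (Fin d) ℝ) (hM : M.det ≠ 0) :
    Measure.map (Matrix.toEuclideanLin M) (volume : Measure (EuclideanSpace ℝ (Fin d))) =
      ENNReal.ofReal |(M.det)⁻¹| • volume := by
  have hdet : LinearMap.det (Matrix.toEuclideanLin M) = M.det := by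
    rw [Matrix.toEuclideanLin_eq_toLin_orthonormal, LinearMap.det_toLin]
  have := Measure.map_linearMap_addHaar_eq_smul_addHaar
    (volume : Measure (EuclideanSpace ℝ (Fin d))) (f := Matrix.toEuclideanLin M)
    (by rwa [hdet])
  rwa [hdet] at this

theorem measurable_toEuclideanLin {d : ℕ} (M : Matrix (Fin d) (Fin d) ℝ) :
    Measurable (Matrix.toEuclideanLin M) :=
  (LinearMap.continuous_of_finiteDimensional _).measurable

theorem quasiMeasurePreserving_toEuclideanLin {d : ℕ} (M : Matrix (Fin d) (Fin d) ℝ)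
    (hM : M.det ≠ 0) :
    Measure.QuasiMeasurePreserving (Matrix.toEuclideanLin M)
      (volume : Measure (EuclideanSpace ℝ (Fin d))) volume :=
  ⟨measurable_toEuclideanLin M, by
    rw [map_toEuclideanLin M hM]; exact Measure.smul_absolutelyContinuous⟩

/-- The function `t ↦ √|det M| f(Mt)`. -/
def dilationFun {d : ℕ} (M : Matrix (Fin d) (Fin d) ℝ) (f : EuclideanSpace ℝ (Fin d) → ℂ) :
    EuclideanSpace ℝ (Fin d) → ℂ :=
  fun t => (Real.sqrt |M.det| : ℂ) * f (Matrix.toEuclideanLin M t)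

theorem memLp_dilationFun {d : ℕ} (M : Matrix (Fin d) (Fin d) ℝ) (hM : M.det ≠ 0)
    {f : EuclideanSpace ℝ (Fin d) → ℂ} (hf : MemLp f 2) : MemLp (dilationFun M f) 2 := by
  refine MemLp.const_mul (MemLp.comp_of_map ?_ (measurable_toEuclideanLin M).aemeasurable) _
  rw [map_toEuclideanLin M hM]
  exact hf.smul_measure ENNReal.ofReal_ne_top

theorem eLpNorm_dilationFun {d : ℕ} (M : Matrix (Fin d) (Fin d) ℝ) (hM : M.det ≠ 0)
    {f : EuclideanSpace ℝ (Fin d) → ℂ} (hf : MemLp f 2) :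
    eLpNorm (dilationFun M f) 2 volume = eLpNorm f 2 volume := by
  have h1 : eLpNorm (fun t => f (Matrix.toEuclideanLin M t)) 2 volume =
      eLpNorm f 2 (Measure.map (Matrix.toEuclideanLin M) volume) := by
    symm
    refine eLpNorm_map_measure ?_ (measurable_toEuclideanLin M).aemeasurable
    rw [map_toEuclideanLin M hM]
    exact (hf.smul_measure ENNReal.ofReal_ne_top).aestronglyMeasurable
  have h2 : dilationFun M f =
      (Real.sqrt |M.det| : ℂ) • fun t => f (Matrix.toEuclideanLin M t) := rfl
  have hpos : 0 < |M.det| := abs_pos.mpr hM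
  rw [h2, eLpNorm_const_smul, h1, map_toEuclideanLin M hM,
    eLpNorm_smul_measure_of_ne_top (by simp), smul_eq_mul, ← mul_assoc]
  have h3 : ‖(Real.sqrt |M.det| : ℂ)‖ₑ = ENNReal.ofReal (Real.sqrt |M.det|) := by
    rw [← ofReal_norm, Complex.norm_real, Real.norm_of_nonneg (Real.sqrt_nonneg _)]
  have h4 : (ENNReal.ofReal |(M.det)⁻¹|) ^ (1 / (2 : ENNReal)).toReal =
      ENNReal.ofReal (Real.sqrt |M.det|)⁻¹ := by
    rw [ENNReal.ofReal_rpow_of_nonneg (abs_nonneg _) (by positivity), abs_inv,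
      ← Real.sqrt_inv, Real.sqrt_eq_rpow]
    norm_num
  rw [h3, h4, ← ENNReal.ofReal_mul (Real.sqrt_nonneg _),
    mul_inv_cancel₀ (Real.sqrt_pos.mpr hpos).ne', ENNReal.ofReal_one, one_mul]

theorem dilationFun_congr {d : ℕ} (M : Matrix (Fin d) (Fin d) ℝ) (hM : M.det ≠ 0)
    {f g : EuclideanSpace ℝ (Fin d) → ℂ} (h : f =ᵐ[volume] g) :
    dilationFun M f =ᵐ[volume] dilationFun M g := by
  filter_upwards [(quasiMeasurePreserving_toEuclideanLin M hM).ae h] with t ht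
  simp only [dilationFun, ht]

theorem dilationFun_comp {d : ℕ} (M N : Matrix (Fin d) (Fin d) ℝ) (h : N * M = 1)
    (f : EuclideanSpace ℝ (Fin d) → ℂ) : dilationFun M (dilationFun N f) = f := by
  have hd : |M.det| * |N.det| = 1 := by
    rw [← abs_mul, mul_comm, ← Matrix.det_mul, h, Matrix.det_one, abs_one]
  funext t
  have ht : Matrix.toEuclideanLin N (Matrix.toEuclideanLin M t) = t := by
    simp [Matrix.toLpLin_apply, h]
  simp only [dilationFun, ht]
  rw [← mul_assoc, ← Complex.ofReal_mul, ← Real.sqrt_mul (abs_nonneg _), hd]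
  simp

/-- The unitary operator `(U_M f)(t) = √|det M| f(Mt)` on `L²(ℝ^d)`, for an invertible real
matrix `M`. -/
def unitaryDilation {d : ℕ} (M : Matrix (Fin d) (Fin d) ℝ) (hM : M.det ≠ 0) :
    L2 d ≃ₗᵢ[ℂ] L2 d where
  toFun f := (memLp_dilationFun M hM (Lp.memLp f)).toLp (dilationFun M f)
  invFun f := (memLp_dilationFun M⁻¹ (by simpa [Matrix.det_nonsing_inv] using hM)
    (Lp.memLp f)).toLp (dilationFun M⁻¹ f)
  map_add' f g := by
    rw [← MemLp.toLp_add, MemLp.toLp_eq_toLp_iff]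
    refine (dilationFun_congr M hM (Lp.coeFn_add f g)).trans (Filter.Eventually.of_forall ?_)
    intro t
    simp [dilationFun, mul_add]
  map_smul' c f := by
    rw [RingHom.id_apply, ← MemLp.toLp_const_smul, MemLp.toLp_eq_toLp_iff]
    refine (dilationFun_congr M hM (Lp.coeFn_smul c f)).trans (Filter.Eventually.of_forall ?_)
    intro t
    simp [dilationFun, mul_left_comm]
  left_inv f := by
    have hM' : M⁻¹.det ≠ 0 := by simpa [Matrix.det_nonsing_inv] using hM
    refine Lp.ext ((MemLp.coeFn_toLp _).trans
      ((dilationFun_congr M⁻¹ hM' (MemLp.coeFn_toLp _)).trans ?_))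
    rw [dilationFun_comp M⁻¹ M (Matrix.mul_nonsing_inv M (isUnit_iff_ne_zero.mpr hM))]
  right_inv f := by
    refine Lp.ext ((MemLp.coeFn_toLp _).trans
      ((dilationFun_congr M hM (MemLp.coeFn_toLp _)).trans ?_))
    rw [dilationFun_comp M M⁻¹ (Matrix.nonsing_inv_mul M (isUnit_iff_ne_zero.mpr hM))]
  norm_map' f := by
    change ‖(memLp_dilationFun M hM (Lp.memLp f)).toLp (dilationFun M f)‖ = ‖f‖
    rw [Lp.norm_toLp, eLpNorm_dilationFun M hM (Lp.memLp f), Lp.norm_def]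

/-- The translation operator `(T_x f)(t) = f(t - x)` on `L²(ℝ^d)`. -/
def translation {d : ℕ} (x : EuclideanSpace ℝ (Fin d)) : L2 d →ₗᵢ[ℂ] L2 d :=
  Lp.compMeasurePreservingₗᵢ ℂ (fun t => t - x) (measurePreserving_sub_right volume x)

theorem det_realMat_ne_zero {d : ℕ} {A : Matrix (Fin d) (Fin d) ℤ} (hA : |A.det| = 2) :
    (realMat A).det ≠ 0 := by
  have h : (realMat A).det = (A.det : ℝ) := (Int.cast_det A).symm
  rw [h]
  intro h0
  rw [Int.cast_eq_zero.mp h0] at hA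
  norm_num at hA

/-- The dilation operator `D_A = U_A` associated with an integral matrix `A` with `|det A| = 2`. -/
def dilation {d : ℕ} (A : Matrix (Fin d) (Fin d) ℤ) (hA : |A.det| = 2) : L2 d ≃ₗᵢ[ℂ] L2 d :=
  unitaryDilation (realMat A) (det_realMat_ne_zero hA)

theorem det_scaling_ne_zero (d : ℕ) :
    (((2 * Real.pi)⁻¹ : ℝ) • (1 : Matrix (Fin d) (Fin d) ℝ)).det ≠ 0 := by
  rw [Matrix.det_smul, Matrix.det_one, mul_one]
  exact pow_ne_zero _ (inv_ne_zero (by positivity))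

/-- The Fourier-Plancherel transform `(F f)(s) = (2π)^{-d/2} ∫ e^{-i s∘t} f(t) dt` (extended from
`L¹ ∩ L²` to `L²`). Mathlib's transform `𝓕` uses the kernel `e^{-2πi s∘t}` and no factor in front,
so that `(F f)(s) = (2π)^{-d/2} (𝓕 f)(s / 2π)`, which is `U_M (𝓕 f)` for `M = (2π)⁻¹ I`. -/
def fourierPlancherel (d : ℕ) : L2 d ≃ₗᵢ[ℂ] L2 d :=
  (Lp.fourierTransformₗᵢ (EuclideanSpace ℝ (Fin d)) ℂ).trans
    (unitaryDilation (((2 * Real.pi)⁻¹ : ℝ) • 1) (det_scaling_ne_zero d))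

/-- `ψ` is a Parseval's frame wavelet associated with `A`: the family `D_A^n T_ℓ ψ`, `n ∈ ℤ`,
`ℓ ∈ ℤ^d`, is a normalized tight frame of `L²(ℝ^d)`. -/
def IsParsevalFrameWavelet {d : ℕ} (A : Matrix (Fin d) (Fin d) ℤ) (hA : |A.det| = 2)
    (ψ : L2 d) : Prop :=
  ∀ f : L2 d, HasSum
    (fun p : ℤ × (Fin d → ℤ) =>
      ‖inner ℂ ((dilation A hA ^ p.1) (translation (latticePoint p.2) ψ)) f‖ ^ 2)
    (‖f‖ ^ 2)

/-! ### Filter, scaling function and wavelet -/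

/-- The filter `m₀(t) = (1/√2) ∑ₙ hₙ e^{-i n∘t}`. -/
def filterFun {d : ℕ} (h : (Fin d → ℤ) → ℂ) (t : EuclideanSpace ℝ (Fin d)) : ℂ :=
  (1 / (Real.sqrt 2 : ℂ)) *
    ∑ᶠ n, h n * Complex.exp (-Complex.I * ((∑ i, (n i : ℝ) * t i : ℝ) : ℂ))

/-- The factor `m₀((A^τ)^{-(j+1)} ξ)`, `j = 0, 1, 2, …`. -/
def productFactor {d : ℕ} (A : Matrix (Fin d) (Fin d) ℤ) (h : (Fin d → ℤ) → ℂ)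
    (ξ : EuclideanSpace ℝ (Fin d)) (j : ℕ) : ℂ :=
  filterFun h (Matrix.toEuclideanLin (((realMat A).transpose)⁻¹ ^ (j + 1)) ξ)

/-- `g(ξ) = (2π)^{-d/2} ∏_{j ≥ 1} m₀((A^τ)^{-j} ξ)`. -/
def scalingSymbol {d : ℕ} (A : Matrix (Fin d) (Fin d) ℤ) (h : (Fin d → ℤ) → ℂ)
    (ξ : EuclideanSpace ℝ (Fin d)) : ℂ :=
  (((2 * Real.pi) ^ (-(d : ℝ) / 2) : ℝ) : ℂ) * ∏' j : ℕ, productFactor A h ξ j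

/-- The scaling function `φ = F⁻¹ g`. -/
def scalingFunction {d : ℕ} (A : Matrix (Fin d) (Fin d) ℤ) (h : (Fin d → ℤ) → ℂ)
    (hg : MemLp (scalingSymbol A h) 2 volume) : L2 d :=
  (fourierPlancherel d).symm (hg.toLp (scalingSymbol A h))

/-- `ψ = ∑ₙ (-1)^{q∘n} conj(h_{ℓ-n}) D_A Tₙ φ`. -/
def waveletOf {d : ℕ} (A : Matrix (Fin d) (Fin d) ℤ) (hA : |A.det| = 2) (ℓ q : Fin d → ℤ)
    (h : (Fin d → ℤ) → ℂ) (φ : L2 d) : L2 d :=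
  ∑ᶠ n : Fin d → ℤ, ((-1 : ℂ) ^ (q ⬝ᵥ n) * (starRingEnd ℂ) (h (ℓ - n))) •
    dilation A hA (translation (latticePoint n) φ)

end Wavelet

end

/-!
Let `Γ` be the infinite product of the mask `m₀` in the unitary normalization of the Fourier
transform. The orthogonality relations make low-pass and high-pass synthesis with the filter a
perfect reconstruction scheme, so refining a vector whose translates satisfy Bessel's inequality
with constant one gives another such vector, and the energies `E n = ∑ₖ |⟨D^n Tₖ φ, f⟩|²` of a
refinable `φ` satisfy `E (n + 1) - E n = ∑ₖ |⟨D^n Tₖ ψ, f⟩|²`. Starting from the indicator of the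
unit cube on the Fourier side, whose translates are orthonormal, the refinements converge pointwise
to `Γ`; by Fatou `Γ` is square integrable, and `φ` inherits the Bessel bound. The frame identity is
then a telescoping sum over the scales: at fine scales `E n → ‖f‖²` by Parseval on the cube and
`Γ 0 = 1`, and at coarse scales `E n → 0` because the rescaled `f` concentrates at the origin. By
the Bessel bound it suffices to check both limits for `f` in a dense set.
-/

open MeasureTheory

noncomputable section

namespace Wavelet

open scoped ComplexConjugate FourierTransform SchwartzMap

open Filter Topology

section FilterBank

variable {G : Type*} [AddCommGroup G]

/-- `χ` is the quadratic character of `G` whose kernel is the range of the injective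
endomorphism `α`; in particular that range has index at most two. -/
structure IsIndexTwoCharacter (α : G →+ G) (χ : AddChar G ℂ) : Prop where
  injective : Function.Injective α
  map_range : ∀ a ∈ Set.range α, χ a = 1
  map_compl : ∀ a ∉ Set.range α, χ a = -1

/-- The finitely supported filter `h` satisfies Lawton's equations: its translates along the range
of `α` are orthonormal. -/
structure IsLawtonFilter (α : G →+ G) (h : G →₀ ℂ) : Prop where
  sum_mul_conj_self : ∑ n ∈ h.support, h n * conj (h n) = 1
  sum_mul_conj_add : ∀ k ∈ Set.range α, k ≠ 0 → ∑ n ∈ h.support, h n * conj (h (n + k)) = 0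

/-- The correlation `u ↦ ∑ₚ w p * c (p + u) * conj (c p)` of `c` with itself, weighted by `w`. -/
def autocorrelation (w c : G → ℂ) (u : G) : ℂ :=
  ∑' p, w p * (c (p + u) * conj (c p))

theorem summable_mul_conj_add {c : G → ℂ} (hc : Summable fun n => ‖c n‖ ^ 2) (u : G) :
    Summable fun p => c (p + u) * conj (c p) := by
  have hshift : Summable fun p => ‖c (p + u)‖ ^ 2 :=
    (Equiv.addRight u).summable_iff (f := fun n => ‖c n‖ ^ 2) |>.mpr hc
  refine .of_norm_bounded (hshift.add hc) fun p => ?_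
  rw [norm_mul, RCLike.norm_conj]
  nlinarith [sq_nonneg (‖c (p + u)‖ - ‖c p‖), sq_nonneg ‖c (p + u)‖, sq_nonneg ‖c p‖]

theorem autocorrelation_one_zero (c : G → ℂ) :
    autocorrelation 1 c 0 = ((∑' p, ‖c p‖ ^ 2 : ℝ) : ℂ) := by
  simp only [autocorrelation, Pi.one_apply, one_mul, add_zero, Complex.mul_conj',
    Complex.ofReal_tsum, Complex.ofReal_pow]

namespace IsIndexTwoCharacter

variable {α : G →+ G} {χ : AddChar G ℂ} (hχ : IsIndexTwoCharacter α χ)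
include hχ

theorem eq_one_or_neg_one (a : G) : χ a = 1 ∨ χ a = -1 := by
  by_cases ha : a ∈ Set.range α
  · exact .inl (hχ.map_range a ha)
  · exact .inr (hχ.map_compl a ha)

theorem mul_self (a : G) : χ a * χ a = 1 := by
  rcases hχ.eq_one_or_neg_one a with h | h <;> simp [h]

theorem norm_eq_one (a : G) : ‖χ a‖ = 1 := by
  rcases hχ.eq_one_or_neg_one a with h | h <;> simp [h]

theorem conj_eq (a : G) : conj (χ a) = χ a := by
  rcases hχ.eq_one_or_neg_one a with h | h <;> simp [h]

theorem map_sub (a b : G) : χ (a - b) = χ a * χ b := by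
  have hab : χ a = χ (a - b) * χ b := by rw [← χ.map_add_eq_mul, sub_add_cancel]
  rw [hab, mul_assoc, hχ.mul_self, mul_one]

/-- `(1 + χ p * χ n) / 2` is the indicator function of the coset of `n`. -/
theorem hasSum_coset {F : G → ℂ} (hF : Summable F) (n : G) :
    HasSum (fun k => F (n + α k)) ((∑' p, F p + χ n * ∑' p, χ p * F p) / 2) := by
  have hχF : Summable fun p => χ p * F p :=
    .of_norm_bounded hF.norm fun p => by rw [norm_mul, hχ.norm_eq_one, one_mul]
  have hinj : Function.Injective fun k => n + α k :=
    (add_right_injective n).comp hχ.injective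
  have hcompl : ∀ p ∉ Set.range fun k => n + α k, (F p + χ n * (χ p * F p)) / 2 = 0 := by
    intro p hp
    have hpn : χ p * χ n = -1 := by
      rw [← hχ.map_sub]
      exact hχ.map_compl _ fun ⟨k, hk⟩ => hp ⟨k, by simp [hk]⟩
    linear_combination F p / 2 * hpn
  refine ((hinj.hasSum_iff hcompl).mpr
    ((hF.hasSum.add (hχF.hasSum.mul_left _)).div_const 2)).congr_fun fun k => ?_
  rw [Function.comp_apply, χ.map_add_eq_mul, hχ.map_range (α k) ⟨k, rfl⟩]
  linear_combination -F (n + α k) / 2 * hχ.mul_self n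

theorem hasSum_norm_sq_sum {c : G → ℂ} (hc : Summable fun n => ‖c n‖ ^ 2) (S : Finset G)
    (a : G → ℂ) (p : G → G) :
    HasSum (fun k => ((‖∑ n ∈ S, a n * c (p n + α k)‖ ^ 2 : ℝ) : ℂ))
      (∑ m ∈ S, ∑ n ∈ S, a m * conj (a n) * ((autocorrelation 1 c (p m - p n) +
        χ (p n) * autocorrelation χ c (p m - p n)) / 2)) := by
  have hpair : ∀ m n, HasSum (fun k => c (p m + α k) * conj (c (p n + α k)))
      ((autocorrelation 1 c (p m - p n) + χ (p n) * autocorrelation χ c (p m - p n)) / 2) := by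
    intro m n
    have := hχ.hasSum_coset (summable_mul_conj_add hc (p m - p n)) (p n)
    simp only [autocorrelation, Pi.one_apply, one_mul]
    refine this.congr_fun fun k => ?_
    rw [show p n + α k + (p m - p n) = p m + α k by abel]
  refine (hasSum_sum fun m _ => hasSum_sum fun n _ =>
    (hpair m n).mul_left (a m * conj (a n))).congr_fun fun k => ?_
  rw [Complex.ofReal_pow, ← Complex.mul_conj', map_sum, Finset.sum_mul_sum]
  simp only [map_mul]
  exact Finset.sum_congr rfl fun m _ => Finset.sum_congr rfl fun n _ => by ring

variable {h : G →₀ ℂ} (hh : IsLawtonFilter α h)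
include hh

theorem sum_autocorrelation (X : G → ℂ) :
    ∑ m ∈ h.support, ∑ n ∈ h.support,
      conj (h m) * h n * ((1 + χ m * χ n) / 2 * X (m - n)) = X 0 := by
  classical
  set U : Finset G := insert 0 (Finset.image₂ (· - ·) h.support h.support)
  have hreindex : ∀ n ∈ h.support,
      ∑ m ∈ h.support, conj (h m) * h n * ((1 + χ m * χ n) / 2 * X (m - n)) =
        ∑ u ∈ U, (1 + χ u) / 2 * X u * (h n * conj (h (n + u))) := by
    intro n hn
    refine Finset.sum_of_injOn (· - n) (sub_left_injective.injOn) ?_ ?_ ?_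
    · intro m hm
      exact Finset.mem_insert_of_mem (Finset.mem_image₂_of_mem hm hn)
    · intro u _ hu
      have : h (n + u) = 0 := Finsupp.notMem_support_iff.mp fun hS => hu ⟨n + u, hS, by simp⟩
      simp [this]
    · intro m _
      rw [add_sub_cancel, hχ.map_sub]
      ring
  have hvanish : ∀ u ∈ U, u ≠ 0 →
      (1 + χ u) / 2 * X u * ∑ n ∈ h.support, h n * conj (h (n + u)) = 0 := by
    intro u _ hu
    by_cases hr : u ∈ Set.range α
    · rw [hh.sum_mul_conj_add u hr hu, mul_zero]
    · simp [hχ.map_compl u hr]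
  rw [Finset.sum_comm, Finset.sum_congr rfl hreindex, Finset.sum_comm]
  simp_rw [← Finset.mul_sum]
  rw [Finset.sum_eq_single_of_mem 0 (Finset.mem_insert_self _ _) hvanish]
  simp [hh.sum_mul_conj_self]

theorem quadrature_mirror (e : AddChar G Circle) :
    ‖∑ n ∈ h.support, h n * (e n : ℂ)‖ ^ 2 + ‖∑ n ∈ h.support, χ n * h n * (e n : ℂ)‖ ^ 2 = 2 := by
  have hauto := hχ.sum_autocorrelation hh fun u => conj (e u : ℂ)
  have hconj : ∀ m n, conj (e (m - n) : ℂ) = conj (e m : ℂ) * e n := fun m n => by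
    simp [e.map_sub_eq_div, div_eq_mul_inv, ← Circle.coe_inv_eq_conj, mul_comm]
  rw [← Complex.ofReal_inj, Complex.ofReal_add, Complex.ofReal_pow, Complex.ofReal_pow,
    ← Complex.conj_mul', ← Complex.conj_mul', map_sum, map_sum, Finset.sum_mul_sum,
    Finset.sum_mul_sum, ← Finset.sum_add_distrib]
  simp only [← Finset.sum_add_distrib]
  rw [Complex.ofReal_ofNat, show (2 : ℂ) = 2 * conj (e 0 : ℂ) by simp, ← hauto, Finset.mul_sum]
  refine Finset.sum_congr rfl fun m _ => ?_
  rw [Finset.mul_sum]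
  refine Finset.sum_congr rfl fun n _ => ?_
  simp only [map_mul, hχ.conj_eq, hconj]
  ring

/-- Perfect reconstruction: the cross terms `autocorrelation χ c` of the two channels cancel. -/
theorem hasSum_filterBank {ℓ : G} (hℓ : ℓ ∉ Set.range α) {c : G → ℂ}
    (hc : Summable fun n => ‖c n‖ ^ 2) :
    HasSum (fun k => ‖∑ n ∈ h.support, conj (h n) * c (n + α k)‖ ^ 2 +
      ‖∑ n ∈ h.support, χ (ℓ - n) * h n * c (ℓ - n + α k)‖ ^ 2) (∑' n, ‖c n‖ ^ 2) := by
  have hlow := hχ.hasSum_norm_sq_sum hc h.support (fun n => conj (h n)) fun n => n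
  have hhigh := hχ.hasSum_norm_sq_sum hc h.support (fun n => χ (ℓ - n) * h n) (ℓ - ·)
  rw [Finset.sum_comm] at hhigh
  rw [← Complex.hasSum_ofReal, ← autocorrelation_one_zero,
    ← hχ.sum_autocorrelation hh (autocorrelation 1 c)]
  simp only [Complex.ofReal_add]
  convert hlow.add hhigh using 1
  rw [← Finset.sum_add_distrib]
  refine Finset.sum_congr rfl fun m _ => ?_
  rw [← Finset.sum_add_distrib]
  refine Finset.sum_congr rfl fun n _ => ?_
  rw [show ℓ - n - (ℓ - m) = m - n by abel]
  simp only [map_mul, Complex.conj_conj, hχ.conj_eq, hχ.map_sub, hχ.map_compl ℓ hℓ,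
    map_neg, map_one]
  linear_combination ((conj (h m) * h n * χ n * autocorrelation χ c (m - n)) / 2) * hχ.mul_self m

end IsIndexTwoCharacter

end FilterBank

section BesselFamilies

variable {ι H : Type*} [NormedAddCommGroup H] [InnerProductSpace ℂ H]

/-- `v` is a Bessel family with bound one. -/
def IsBesselOne (v : ι → H) : Prop :=
  ∀ (f : H) (F : Finset ι), ∑ k ∈ F, ‖inner ℂ (v k) f‖ ^ 2 ≤ ‖f‖ ^ 2

/-- The energy of the coefficients of `f` with respect to the family `v`. -/
def energy (v : ι → H) (f : H) : ℝ :=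
  ∑' k, ‖inner ℂ (v k) f‖ ^ 2

theorem energy_nonneg (v : ι → H) (f : H) : 0 ≤ energy v f :=
  tsum_nonneg fun _ => sq_nonneg _

namespace IsBesselOne

variable {v : ι → H} (hv : IsBesselOne v)
include hv

theorem summable (f : H) : Summable fun k => ‖inner ℂ (v k) f‖ ^ 2 :=
  summable_of_sum_le (fun _ => sq_nonneg _) (hv f)

theorem hasSum_energy (f : H) : HasSum (fun k => ‖inner ℂ (v k) f‖ ^ 2) (energy v f) :=
  (hv.summable f).hasSum

theorem energy_le (f : H) : energy v f ≤ ‖f‖ ^ 2 :=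
  (hv.summable f).tsum_le_of_sum_le (hv f)

theorem norm_le_one (k : ι) : ‖v k‖ ≤ 1 := by
  by_contra! hlt
  have hle := hv (v k) {k}
  rw [Finset.sum_singleton, inner_self_eq_norm_sq_to_K, norm_pow, RCLike.norm_ofReal,
    abs_norm] at hle
  nlinarith [one_lt_pow₀ hlt two_ne_zero]

/-- The analysis operator of a Bessel family, which maps `f` to its coefficients. -/
def analysis : H →ₗ[ℂ] lp (fun _ : ι => ℂ) 2 where
  toFun f := ⟨fun k => inner ℂ (v k) f, memℓp_gen (by simpa using hv.summable f)⟩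
  map_add' f g := by
    ext k
    exact inner_add_right _ _ _
  map_smul' c f := by
    ext k
    exact inner_smul_right _ _ _

theorem norm_analysis_sq (f : H) : ‖hv.analysis f‖ ^ 2 = energy v f := by
  simpa [analysis, energy] using lp.norm_rpow_eq_tsum (p := 2) (by norm_num) (hv.analysis f)

theorem norm_analysis_le (f : H) : ‖hv.analysis f‖ ≤ ‖f‖ := by
  rw [← sq_le_sq₀ (norm_nonneg _) (norm_nonneg _), hv.norm_analysis_sq]
  exact hv.energy_le f

theorem lipschitzWith_norm_analysis_comp (U : H →ₗᵢ[ℂ] H) :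
    LipschitzWith 1 fun f => ‖hv.analysis (U f)‖ :=
  .of_dist_le_mul fun x y => by
    rw [NNReal.coe_one, one_mul, dist_eq_norm x y]
    calc |‖hv.analysis (U x)‖ - ‖hv.analysis (U y)‖|
        ≤ ‖hv.analysis (U x) - hv.analysis (U y)‖ := abs_norm_sub_norm_le _ _
      _ = ‖hv.analysis (U (x - y))‖ := by rw [map_sub, map_sub]
      _ ≤ ‖U (x - y)‖ := hv.norm_analysis_le _
      _ = ‖x - y‖ := U.norm_map _

theorem tendsto_energy_of_dense {β : Type*} {l : Filter β} (U : β → H →ₗᵢ[ℂ] H) {Φ : H → ℝ}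
    (hΦ : Continuous Φ) {s : Set H} (hs : Dense s)
    (hconv : ∀ f ∈ s, Tendsto (fun i => energy v (U i f)) l (𝓝 (Φ f))) (f : H) :
    Tendsto (fun i => energy v (U i f)) l (𝓝 (Φ f)) := by
  rcases l.eq_or_neBot with rfl | _
  · exact tendsto_bot
  have hclosed : IsClosed {f | Tendsto (fun i => ‖hv.analysis (U i f)‖) l (𝓝 √(Φ f))} :=
    (LipschitzWith.uniformEquicontinuous _ 1 fun i =>
      hv.lipschitzWith_norm_analysis_comp (U i)).equicontinuous.isClosed_setOfPred_tendsto
        hΦ.sqrt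
  have hsqrt : ∀ g, √(energy v g) = ‖hv.analysis g‖ := fun g => by
    rw [← hv.norm_analysis_sq, Real.sqrt_sq (norm_nonneg _)]
  have hnonneg : 0 ≤ Φ f := by
    refine (isClosed_le continuous_const hΦ).closure_subset_iff.mpr (fun g hg => ?_) (hs f)
    exact ge_of_tendsto' (hconv g hg) fun i => energy_nonneg _ _
  have hlim : Tendsto (fun i => ‖hv.analysis (U i f)‖) l (𝓝 √(Φ f)) :=
    hclosed.closure_subset_iff.mpr
      (fun g hg => by
        simpa only [Set.mem_ofPred_eq, hsqrt] using (hconv g hg).sqrt) (hs f)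
  simpa only [hv.norm_analysis_sq, Real.sq_sqrt hnonneg] using hlim.pow 2

end IsBesselOne

theorem IsBesselOne.of_tendsto_inner {β : Type*} {l : Filter β} [l.NeBot] {v : β → ι → H}
    (hv : ∀ i, IsBesselOne (v i)) {w : ι → H} {s : Set H} (hs : Dense s)
    (hlim : ∀ g ∈ s, ∀ k, Tendsto (fun i => inner ℂ (v i k) g) l (𝓝 (inner ℂ (w k) g))) :
    IsBesselOne w := by
  intro f F
  have hclosed : IsClosed {f : H | ∑ k ∈ F, ‖inner ℂ (w k) f‖ ^ 2 ≤ ‖f‖ ^ 2} :=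
    isClosed_le (by fun_prop) (by fun_prop)
  refine hclosed.closure_subset_iff.mpr (fun g hg => ?_) (hs f)
  exact le_of_tendsto' (tendsto_finsetSum F fun k _ => (hlim g hg k).norm.pow 2)
    fun i => hv i g F

end BesselFamilies

section Refinement

variable {G H : Type*} [AddCommGroup G] [NormedAddCommGroup H] [InnerProductSpace ℂ H]

/-- A dilation and a family of translations with `T_k D = D T_{α k}`. -/
structure IsDilationSystem (α : G →+ G) (D : H ≃ₗᵢ[ℂ] H) (T : G → H →ₗᵢ[ℂ] H) : Prop where
  add_apply : ∀ a b f, T (a + b) f = T a (T b f)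
  comm : ∀ k f, T k (D f) = D (T (α k) f)

/-- The low-pass synthesis operator `φ ↦ ∑ₙ h n • D Tₙ φ`, whose fixed points are the refinable
vectors. -/
def refinement (h : G →₀ ℂ) (D : H ≃ₗᵢ[ℂ] H) (T : G → H →ₗᵢ[ℂ] H) (φ : H) : H :=
  ∑ n ∈ h.support, h n • D (T n φ)

/-- The high-pass synthesis operator, which produces the wavelet of a refinable vector `φ`; in
terms of `m = ℓ - n` it is `∑ₘ χ m * conj (h (ℓ - m)) • D Tₘ φ`. -/
def detail (h : G →₀ ℂ) (χ : AddChar G ℂ) (ℓ : G) (D : H ≃ₗᵢ[ℂ] H) (T : G → H →ₗᵢ[ℂ] H)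
    (φ : H) : H :=
  ∑ n ∈ h.support, (χ (ℓ - n) * conj (h n)) • D (T (ℓ - n) φ)

theorem inner_isometryEquiv_left (D : H ≃ₗᵢ[ℂ] H) (u f : H) :
    inner ℂ (D u) f = inner ℂ u (D⁻¹ f) := by
  conv_lhs => rw [← D.apply_symm_apply f]
  exact D.inner_map_map _ _

theorem hasSum_sub_of_monotone_nat {p : ℕ → ℝ} (hp : Monotone p) {a : ℝ}
    (ha : Tendsto p atTop (𝓝 a)) : HasSum (fun n => p (n + 1) - p n) (a - p 0) := by
  rw [hasSum_iff_tendsto_nat_of_nonneg fun n => sub_nonneg.mpr (hp n.le_succ)]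
  simpa only [Finset.sum_range_sub] using ha.sub_const (p 0)

theorem hasSum_sub_of_monotone_int {p : ℤ → ℝ} (hp : Monotone p) {a b : ℝ}
    (ha : Tendsto p atTop (𝓝 a)) (hb : Tendsto p atBot (𝓝 b)) :
    HasSum (fun n => p (n + 1) - p n) (a - b) := by
  have hright : HasSum (fun n : ℕ => p ((n : ℤ) + 1) - p n) (a - p 0) := by
    have := hasSum_sub_of_monotone_nat (p := fun n : ℕ => p n)
      (fun m n hmn => hp (Int.ofNat_le.mpr hmn)) (ha.comp tendsto_natCast_atTop_atTop)
    simpa only [Nat.cast_succ, Nat.cast_zero] using this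
  have hleft : HasSum (fun n : ℕ => p (-((n : ℤ) + 1) + 1) - p (-((n : ℤ) + 1))) (p 0 - b) := by
    have := hasSum_sub_of_monotone_nat (p := fun n : ℕ => -p (-(n : ℤ)))
      (fun m n hmn => neg_le_neg (hp (neg_le_neg (Int.ofNat_le.mpr hmn))))
      (hb.comp (tendsto_neg_atTop_atBot.comp tendsto_natCast_atTop_atTop)).neg
    simpa [neg_add_eq_sub] using this
  have := HasSum.of_nat_of_neg_add_one (f := fun n => p (n + 1) - p n) hright hleft
  rwa [sub_add_sub_cancel] at this

variable {α : G →+ G} {D : H ≃ₗᵢ[ℂ] H} {T : G → H →ₗᵢ[ℂ] H} {χ : AddChar G ℂ} {h : G →₀ ℂ}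
  {ℓ : G} {φ : H}

namespace IsDilationSystem

variable (hT : IsDilationSystem α D T)
include hT

theorem inner_refinement (h : G →₀ ℂ) (φ f : H) (k : G) :
    inner ℂ (T k (refinement h D T φ)) f =
      ∑ n ∈ h.support, conj (h n) * inner ℂ (T (n + α k) φ) (D⁻¹ f) := by
  simp only [refinement, map_sum, map_smul, sum_inner, inner_smul_left, hT.comm, ← hT.add_apply,
    inner_isometryEquiv_left, add_comm]

theorem inner_detail (hχ : IsIndexTwoCharacter α χ) (h : G →₀ ℂ) (ℓ : G) (φ f : H) (k : G) :
    inner ℂ (T k (detail h χ ℓ D T φ)) f =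
      ∑ n ∈ h.support, χ (ℓ - n) * h n * inner ℂ (T (ℓ - n + α k) φ) (D⁻¹ f) := by
  simp only [detail, map_sum, map_smul, sum_inner, inner_smul_left, hT.comm, ← hT.add_apply,
    inner_isometryEquiv_left, map_mul, hχ.conj_eq, Complex.conj_conj, add_comm]

variable (hχ : IsIndexTwoCharacter α χ) (hh : IsLawtonFilter α h) (hℓ : ℓ ∉ Set.range α)
  (hφ : IsBesselOne fun k => T k φ)
include hχ hh hℓ hφ

theorem hasSum_refinement_add_detail (f : H) :
    HasSum (fun k => ‖inner ℂ (T k (refinement h D T φ)) f‖ ^ 2 +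
      ‖inner ℂ (T k (detail h χ ℓ D T φ)) f‖ ^ 2) (energy (fun k => T k φ) (D⁻¹ f)) := by
  simp only [hT.inner_refinement, hT.inner_detail hχ]
  exact hχ.hasSum_filterBank hh hℓ (c := fun k => inner ℂ (T k φ) (D⁻¹ f)) (hφ.summable _)

theorem isBesselOne_refinement : IsBesselOne fun k => T k (refinement h D T φ) := by
  intro f F
  calc ∑ k ∈ F, ‖inner ℂ (T k (refinement h D T φ)) f‖ ^ 2
      ≤ ∑ k ∈ F, (‖inner ℂ (T k (refinement h D T φ)) f‖ ^ 2 +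
        ‖inner ℂ (T k (detail h χ ℓ D T φ)) f‖ ^ 2) :=
        Finset.sum_le_sum fun k _ => le_add_of_nonneg_right (sq_nonneg _)
    _ ≤ energy (fun k => T k φ) (D⁻¹ f) :=
        sum_le_hasSum _ (fun _ _ => by positivity)
          (hT.hasSum_refinement_add_detail hχ hh hℓ hφ f)
    _ ≤ ‖D⁻¹ f‖ ^ 2 := hφ.energy_le _
    _ = ‖f‖ ^ 2 := by rw [LinearIsometryEquiv.norm_map]

variable (hfix : refinement h D T φ = φ)
include hfix

theorem hasSum_detail (f : H) :
    HasSum (fun k => ‖inner ℂ (T k (detail h χ ℓ D T φ)) f‖ ^ 2)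
      (energy (fun k => T k φ) (D⁻¹ f) - energy (fun k => T k φ) f) := by
  have hsum := hT.hasSum_refinement_add_detail hχ hh hℓ hφ f
  rw [hfix] at hsum
  simpa only [add_sub_cancel_left] using hsum.sub (hφ.hasSum_energy f)

/-- The wavelet coefficients at scale `n` carry the difference of the energies at the scales
`n + 1` and `n`, so their energies telescope. -/
theorem hasSum_wavelet_coefficients {f : H}
    (hfine : Tendsto (fun n : ℤ => energy (fun k => T k φ) ((D ^ (-n)) f)) atTop (𝓝 (‖f‖ ^ 2)))
    (hcoarse : Tendsto (fun n : ℤ => energy (fun k => T k φ) ((D ^ (-n)) f)) atBot (𝓝 0)) :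
    HasSum (fun p : ℤ × G => ‖inner ℂ ((D ^ p.1) (T p.2 (detail h χ ℓ D T φ))) f‖ ^ 2)
      (‖f‖ ^ 2) := by
  set E : ℤ → ℝ := fun n => energy (fun k => T k φ) ((D ^ (-n)) f)
  have hscale : ∀ n : ℤ, HasSum
      (fun k => ‖inner ℂ ((D ^ n) (T k (detail h χ ℓ D T φ))) f‖ ^ 2) (E (n + 1) - E n) := by
    intro n
    simp only [inner_isometryEquiv_left, ← zpow_neg]
    convert hT.hasSum_detail hχ hh hℓ hφ hfix ((D ^ (-n)) f) using 3
    rw [neg_add_rev, zpow_add, zpow_neg_one]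
    rfl
  have hmono : Monotone E := monotone_int_of_le_succ fun n =>
    sub_nonneg.mp ((hscale n).nonneg fun _ => sq_nonneg _)
  have htelescope : HasSum (fun n => E (n + 1) - E n) (‖f‖ ^ 2) := by
    simpa only [sub_zero] using hasSum_sub_of_monotone_int hmono hfine hcoarse
  have hsummable : Summable fun p : ℤ × G =>
      ‖inner ℂ ((D ^ p.1) (T p.2 (detail h χ ℓ D T φ))) f‖ ^ 2 := by
    refine (summable_prod_of_nonneg fun _ => sq_nonneg _).mpr ⟨fun n => (hscale n).summable, ?_⟩
    simpa only [(hscale _).tsum_eq] using htelescope.summable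
  rw [htelescope.unique (hsummable.hasSum.prod_fiberwise hscale)]
  exact hsummable.hasSum

end IsDilationSystem

end Refinement

section ContractiveProduct

/-- A low-pass symbol: bounded by one and Lipschitz at the origin, where it takes the value one. -/
structure IsLowPass {E : Type*} [NormedAddCommGroup E] (m : E → ℂ) : Prop where
  continuous : Continuous m
  norm_le_one : ∀ ξ, ‖m ξ‖ ≤ 1
  exists_norm_sub_one_le : ∃ L, 0 ≤ L ∧ ∀ ξ, ‖m ξ - 1‖ ≤ L * ‖ξ‖

/-- The infinite product `∏_{j ≥ 1} m (Bʲ ξ)` of the cascade algorithm. -/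
def cascadeProduct {E : Type*} [NormedAddCommGroup E] [NormedSpace ℝ E] (B : E →L[ℝ] E) (m : E → ℂ)
    (ξ : E) : ℂ :=
  ∏' j : ℕ, m ((B ^ (j + 1)) ξ)

namespace IsLowPass

variable {E : Type*} [NormedAddCommGroup E] {m : E → ℂ} (hm : IsLowPass m)
include hm

theorem map_zero : m 0 = 1 := by
  obtain ⟨L, -, hL⟩ := hm.exists_norm_sub_one_le
  simpa [sub_eq_zero] using hL 0

variable [NormedSpace ℝ E] {B : E →L[ℝ] E}

theorem norm_prod_range_le_one (B : E →L[ℝ] E) (k : ℕ) (ξ : E) :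
    ‖∏ j ∈ Finset.range k, m ((B ^ (j + 1)) ξ)‖ ≤ 1 := by
  rw [norm_prod]
  exact Finset.prod_le_one (fun _ _ => norm_nonneg _) fun _ _ => hm.norm_le_one _

theorem cascadeProduct_zero : cascadeProduct B m 0 = 1 := by
  simp [cascadeProduct, hm.map_zero]

variable (hB : Summable fun n => ‖B ^ n‖)
include hB

theorem exists_summable_norm_sub_one_le (R : ℝ) :
    ∃ b : ℕ → ℝ, Summable b ∧ ∀ ξ, ‖ξ‖ ≤ R → ∀ j, ‖m ((B ^ (j + 1)) ξ) - 1‖ ≤ b j := by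
  obtain ⟨L, hL0, hL⟩ := hm.exists_norm_sub_one_le
  refine ⟨fun j => L * (‖B ^ (j + 1)‖ * R),
    (((summable_nat_add_iff 1).mpr hB).mul_right R).mul_left L, fun ξ hξ j => ?_⟩
  calc ‖m ((B ^ (j + 1)) ξ) - 1‖ ≤ L * ‖(B ^ (j + 1)) ξ‖ := hL _
    _ ≤ L * (‖B ^ (j + 1)‖ * R) := by gcongr; exact (B ^ (j + 1)).le_opNorm_of_le hξ

theorem multipliable (ξ : E) : Multipliable fun j : ℕ => m ((B ^ (j + 1)) ξ) := by
  obtain ⟨b, hb, hbound⟩ := hm.exists_summable_norm_sub_one_le hB ‖ξ‖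
  simpa using multipliable_one_add_of_summable
    (Summable.of_nonneg_of_le (fun _ => norm_nonneg _) (hbound ξ le_rfl) hb)

theorem tendsto_prod_range (ξ : E) :
    Tendsto (fun k => ∏ j ∈ Finset.range k, m ((B ^ (j + 1)) ξ)) atTop
      (𝓝 (cascadeProduct B m ξ)) :=
  (hm.multipliable hB ξ).hasProd.tendsto_prod_nat

theorem norm_cascadeProduct_le_one (ξ : E) : ‖cascadeProduct B m ξ‖ ≤ 1 :=
  le_of_tendsto' (hm.tendsto_prod_range hB ξ).norm fun k => hm.norm_prod_range_le_one B k ξ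

theorem cascadeProduct_eq_mul (ξ : E) :
    cascadeProduct B m ξ = m (B ξ) * cascadeProduct B m (B ξ) := by
  refine tendsto_nhds_unique ((tendsto_add_atTop_iff_nat 1).mpr (hm.tendsto_prod_range hB ξ)) ?_
  refine ((hm.tendsto_prod_range hB (B ξ)).const_mul (m (B ξ))).congr fun k => ?_
  simp only [Finset.prod_range_succ', zero_add, pow_one, mul_comm (m (B ξ)), pow_succ B (_ + 1),
    mul_apply_eq_comp]

theorem continuous_cascadeProduct : Continuous (cascadeProduct B m) := by
  refine continuous_iff_continuousAt.mpr fun ξ₀ => ?_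
  obtain ⟨b, hb, hbound⟩ := hm.exists_summable_norm_sub_one_le hB (‖ξ₀‖ + 1)
  have hball : ∀ᶠ ξ in 𝓝 ξ₀, ‖ξ‖ ≤ ‖ξ₀‖ + 1 :=
    (continuous_norm.tendsto ξ₀).eventually_le_const (lt_add_one _)
  have hfactor : ∀ j : ℕ, Tendsto (fun ξ => m ((B ^ (j + 1)) ξ) - 1) (𝓝 ξ₀)
      (𝓝 (m ((B ^ (j + 1)) ξ₀) - 1)) := fun j =>
    ((hm.continuous.comp (B ^ (j + 1)).continuous).sub continuous_const).tendsto ξ₀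
  have := tendsto_tprod_one_add_of_dominated_convergence hb hfactor
    (hball.mono fun ξ hξ => hbound ξ hξ)
  simp only [add_sub_cancel] at this
  exact this

end IsLowPass

end ContractiveProduct

section Expansive

theorem summable_norm_pow_of_spectrum {𝔸 : Type*} [NormedRing 𝔸] [NormedAlgebra ℂ 𝔸]
    [CompleteSpace 𝔸] [Nontrivial 𝔸] {a : 𝔸} (ha : ∀ z ∈ spectrum ℂ a, ‖z‖ < 1) :
    Summable fun n : ℕ => ‖a ^ n‖ := by
  have hradius : spectralRadius ℂ a < (1 : NNReal) :=
    spectrum.spectralRadius_lt_of_forall_lt a ha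
  obtain ⟨θ, hθ, hθ1⟩ := ENNReal.lt_iff_exists_nnreal_btwn.mp hradius
  have hgeom : Summable fun n : ℕ => (θ : ℝ) ^ n :=
    summable_geometric_of_lt_one θ.coe_nonneg (by exact_mod_cast hθ1)
  refine .of_norm_bounded_eventually_nat hgeom ?_
  have hgelfand := spectrum.pow_nnnorm_pow_one_div_tendsto_nhds_spectralRadius a
  filter_upwards [hgelfand.eventually_lt_const hθ, eventually_gt_atTop 0] with n hroot hn
  rw [one_div, ENNReal.rpow_inv_lt_iff (by positivity), ENNReal.rpow_natCast] at hroot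
  rw [norm_norm]
  exact_mod_cast hroot.le

variable {d : ℕ}

theorem realMat_inv_pow (A : Matrix (Fin d) (Fin d) ℤ) (hdet : |A.det| = 2) (n : ℕ) :
    (realMat A)⁻¹ ^ n = ((A.map fun z => (z : ℂ))⁻¹ ^ n).map Complex.re := by
  have hmap : (A.map fun z => (z : ℂ)) = Complex.ofRealHom.mapMatrix (realMat A) := by
    ext i j
    simp [realMat]
  have hinv : (Complex.ofRealHom.mapMatrix (realMat A))⁻¹ =
      Complex.ofRealHom.mapMatrix (realMat A)⁻¹ := by
    refine Matrix.inv_eq_left_inv ?_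
    rw [← map_mul, Matrix.nonsing_inv_mul _ (det_realMat_ne_zero hdet).isUnit, map_one]
  rw [hmap, hinv, ← map_pow]
  ext i j
  simp

theorem IsExpansive.norm_lt_one_of_mem_spectrum_inv {A : Matrix (Fin d) (Fin d) ℤ}
    (hexp : IsExpansive A) (hdet : A.det ≠ 0) {z : ℂ}
    (hz : z ∈ spectrum ℂ (A.map fun z => (z : ℂ))⁻¹) : ‖z‖ < 1 := by
  have hunit : IsUnit (A.map fun z => (z : ℂ)) := by
    rw [Matrix.isUnit_iff_isUnit_det, isUnit_iff_ne_zero]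
    exact (Int.cast_det A).symm.trans_ne (Int.cast_ne_zero.mpr hdet)
  obtain ⟨u, hu⟩ := hunit
  rw [← hu, ← Matrix.coe_units_inv] at hz
  have hlt := hexp _ (hu ▸ spectrum.inv₀_mem_iff.mpr hz)
  rw [norm_inv] at hlt
  by_contra! hle
  exact (inv_le_one_of_one_le₀ hle).not_gt hlt

/-- The linear map `ξ ↦ (A^τ)⁻¹ ξ` of `ℝ^d`. -/
def dualContraction (A : Matrix (Fin d) (Fin d) ℤ) :
    EuclideanSpace ℝ (Fin d) →L[ℝ] EuclideanSpace ℝ (Fin d) :=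
  Matrix.toEuclideanCLM (𝕜 := ℝ) (realMat A).transpose⁻¹

theorem dualContraction_pow_apply (A : Matrix (Fin d) (Fin d) ℤ) (n : ℕ)
    (ξ : EuclideanSpace ℝ (Fin d)) :
    (dualContraction A ^ n) ξ = Matrix.toEuclideanLin ((realMat A).transpose⁻¹ ^ n) ξ := by
  rw [dualContraction, ← map_pow]
  rfl

section Norms

open scoped Matrix.Norms.L2Operator

variable {A : Matrix (Fin d) (Fin d) ℤ} (hexp : IsExpansive A) (hdet : |A.det| = 2)
include hexp hdet

theorem IsExpansive.summable_norm_inv_pow : Summable fun n : ℕ => ‖(realMat A)⁻¹ ^ n‖ := by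
  have hdet0 : A.det ≠ 0 := fun h => by simp [h] at hdet
  have : Nonempty (Fin d) := by
    by_contra! hempty
    simp at hdet
  let re : Matrix (Fin d) (Fin d) ℂ →L[ℝ] Matrix (Fin d) (Fin d) ℝ :=
    LinearMap.toContinuousLinearMap Complex.reLm.mapMatrix
  have hsum := summable_norm_pow_of_spectrum fun z hz =>
    hexp.norm_lt_one_of_mem_spectrum_inv hdet0 hz
  refine .of_nonneg_of_le (fun _ => norm_nonneg _) (fun n => ?_) (hsum.mul_left ‖re‖)
  rw [realMat_inv_pow A hdet n]
  exact re.le_opNorm _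

theorem IsExpansive.summable_norm_dualContraction_pow :
    Summable fun n : ℕ => ‖dualContraction A ^ n‖ := by
  refine (hexp.summable_norm_inv_pow hdet).congr fun n => ?_
  rw [dualContraction, ← map_pow, Matrix.l2_opNorm_toEuclideanCLM,
    ← Matrix.l2_opNorm_conjTranspose, Matrix.conjTranspose_eq_transpose_of_trivial,
    Matrix.transpose_pow, Matrix.transpose_nonsing_inv]

end Norms

end Expansive

section FourierOperators

variable {d : ℕ}

/-- The character `x ↦ e^{-2πi x∘w}` of `ℝ^d`, the kernel of Mathlib's Fourier transform. -/
def phase (x w : EuclideanSpace ℝ (Fin d)) : Circle :=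
  Real.fourierChar (-inner ℝ x w)

theorem phase_zero (w : EuclideanSpace ℝ (Fin d)) : phase 0 w = 1 := by
  simp [phase]

theorem phase_add (x y w : EuclideanSpace ℝ (Fin d)) :
    phase (x + y) w = phase x w * phase y w := by
  rw [phase, inner_add_left, neg_add, AddChar.map_add_eq_mul, phase, phase]

theorem coe_phase (x w : EuclideanSpace ℝ (Fin d)) :
    (phase x w : ℂ) = Complex.exp (Complex.I * (-(2 * Real.pi * inner ℝ x w) : ℝ)) := by
  rw [phase, Real.fourierChar_apply, mul_comm, mul_neg]

theorem continuous_phase (x : EuclideanSpace ℝ (Fin d)) : Continuous (phase x) :=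
  Real.continuous_fourierChar.comp (by fun_prop)

theorem norm_phase_sub_one_le (x w : EuclideanSpace ℝ (Fin d)) :
    ‖(phase x w : ℂ) - 1‖ ≤ 2 * Real.pi * ‖x‖ * ‖w‖ := by
  rw [coe_phase]
  refine Real.norm_exp_I_mul_ofReal_sub_one_le.trans ?_
  rw [norm_neg, norm_mul, Real.norm_of_nonneg (by positivity), mul_assoc _ ‖x‖]
  exact mul_le_mul_of_nonneg_left (norm_inner_le_norm (𝕜 := ℝ) x w) (by positivity)

theorem memLp_phase_smul (x : EuclideanSpace ℝ (Fin d)) {f : EuclideanSpace ℝ (Fin d) → ℂ}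
    (hf : MemLp f 2) : MemLp (fun w => phase x w • f w) 2 :=
  hf.congr_norm ((continuous_phase x).aestronglyMeasurable.smul hf.aestronglyMeasurable)
    (.of_forall fun _ => (Circle.norm_smul _ _).symm)

/-- Multiplication by the character `e^{-2πi x∘w}` on `L²(ℝ^d)`, the Fourier conjugate of the
translation by `x`. -/
def modulation (x : EuclideanSpace ℝ (Fin d)) : L2 d →ₗᵢ[ℂ] L2 d where
  toFun f := (memLp_phase_smul x (Lp.memLp f)).toLp _
  map_add' f g := by
    rw [← MemLp.toLp_add, MemLp.toLp_eq_toLp_iff]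
    filter_upwards [Lp.coeFn_add f g] with w hw
    rw [hw]
    exact smul_add _ _ _
  map_smul' c f := by
    rw [RingHom.id_apply, ← MemLp.toLp_const_smul, MemLp.toLp_eq_toLp_iff]
    filter_upwards [Lp.coeFn_smul c f] with w hw
    rw [hw]
    exact smul_comm (phase x w) c (f w)
  norm_map' f := by
    change ‖(memLp_phase_smul x (Lp.memLp f)).toLp _‖ = ‖f‖
    rw [Lp.norm_toLp, Lp.norm_def]
    congr 1
    exact eLpNorm_congr_norm_ae (.of_forall fun _ => Circle.norm_smul _ _)

theorem coeFn_modulation (x : EuclideanSpace ℝ (Fin d)) (f : L2 d) :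
    modulation x f =ᵐ[volume] fun w => phase x w • f w :=
  MemLp.coeFn_toLp (memLp_phase_smul x (Lp.memLp f))

theorem coeFn_translation (x : EuclideanSpace ℝ (Fin d)) (f : L2 d) :
    translation x f =ᵐ[volume] fun t => f (t - x) :=
  Lp.coeFn_compMeasurePreserving f (measurePreserving_sub_right volume x)

theorem coeFn_unitaryDilation (M : Matrix (Fin d) (Fin d) ℝ) (hM : M.det ≠ 0) (f : L2 d) :
    unitaryDilation M hM f =ᵐ[volume] dilationFun M f :=
  MemLp.coeFn_toLp (memLp_dilationFun M hM (Lp.memLp f))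

/-- The Fourier transform on `L²(ℝ^d)` with kernel `e^{-2πi x∘w}`. -/
abbrev fourierL2 (d : ℕ) : L2 d ≃ₗᵢ[ℂ] L2 d :=
  Lp.fourierTransformₗᵢ (EuclideanSpace ℝ (Fin d)) ℂ

theorem fourierL2_toLp (f : 𝓢(EuclideanSpace ℝ (Fin d), ℂ)) :
    fourierL2 d (f.toLp 2) = (𝓕 f).toLp 2 :=
  SchwartzMap.toLp_fourier_eq f

theorem eq_of_eq_schwartz {S T : L2 d → L2 d} (hS : Continuous S) (hT : Continuous T)
    (h : ∀ f : 𝓢(EuclideanSpace ℝ (Fin d), ℂ), S (f.toLp 2) = T (f.toLp 2)) : S = T :=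
  (SchwartzMap.denseRange_toLpCLM (E := EuclideanSpace ℝ (Fin d)) (F := ℂ) (p := 2)
    (μ := volume) ENNReal.ofNat_ne_top).equalizer hS hT (funext h)

theorem fourier_comp_sub_right (f : EuclideanSpace ℝ (Fin d) → ℂ)
    (x w : EuclideanSpace ℝ (Fin d)) : 𝓕 (fun t => f (t - x)) w = phase x w • 𝓕 f w := by
  have := congrFun (VectorFourier.fourierIntegral_comp_add_right Real.fourierChar volume
    (innerₗ (EuclideanSpace ℝ (Fin d))) f (-x)) w
  simp only [Function.comp_def, ← sub_eq_add_neg, innerₗ_apply_apply, inner_neg_left] at this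
  exact this

theorem fourierL2_translation (x : EuclideanSpace ℝ (Fin d)) (f : L2 d) :
    fourierL2 d (translation x f) = modulation x (fourierL2 d f) := by
  refine congrFun (eq_of_eq_schwartz (S := fun f => fourierL2 d (translation x f))
    (T := fun f => modulation x (fourierL2 d f))
    ((fourierL2 d).continuous.comp (translation x).continuous)
    ((modulation x).continuous.comp (fourierL2 d).continuous) fun f => ?_) f
  have htranslate : translation x (f.toLp 2) = (f.compSubConstCLM ℂ x).toLp 2 := by
    refine Lp.ext ((coeFn_translation x _).trans ?_)
    filter_upwards [(f.compSubConstCLM ℂ x).coeFn_toLp 2,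
      (measurePreserving_sub_right volume x).quasiMeasurePreserving.ae_eq_comp (f.coeFn_toLp 2)]
      with t h₁ h₂
    rw [h₁]
    exact h₂
  simp only [htranslate, fourierL2_toLp]
  refine Lp.ext (.trans ?_ (coeFn_modulation x _).symm)
  filter_upwards [(𝓕 f).coeFn_toLp 2, (𝓕 (f.compSubConstCLM ℂ x)).coeFn_toLp 2] with w h₁ h₂
  rw [h₁, h₂, SchwartzMap.fourier_coe, SchwartzMap.fourier_coe]
  exact fourier_comp_sub_right f x w

theorem det_inv_transpose_ne_zero {M : Matrix (Fin d) (Fin d) ℝ} (hM : M.det ≠ 0) :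
    (M.transpose⁻¹).det ≠ 0 := by
  rw [Matrix.det_nonsing_inv, Matrix.det_transpose, Ring.inverse_eq_inv']
  exact inv_ne_zero hM

theorem toEuclideanLin_mul_apply (M N : Matrix (Fin d) (Fin d) ℝ) (x : EuclideanSpace ℝ (Fin d)) :
    Matrix.toEuclideanLin M (Matrix.toEuclideanLin N x) = Matrix.toEuclideanLin (M * N) x := by
  rw [Matrix.toLpLin_mul_same]
  rfl

theorem inner_toEuclideanLin_left (M : Matrix (Fin d) (Fin d) ℝ)
    (x y : EuclideanSpace ℝ (Fin d)) :
    inner ℝ (Matrix.toEuclideanLin M x) y = inner ℝ x (Matrix.toEuclideanLin M.transpose y) := by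
  rw [← Matrix.conjTranspose_eq_transpose_of_trivial,
    Matrix.toEuclideanLin_conjTranspose_eq_adjoint, LinearMap.adjoint_inner_right]

/-- An invertible matrix as a continuous linear automorphism of `ℝ^d`. -/
def euclideanEquiv (M : Matrix (Fin d) (Fin d) ℝ) (hM : M.det ≠ 0) :
    EuclideanSpace ℝ (Fin d) ≃L[ℝ] EuclideanSpace ℝ (Fin d) :=
  (LinearEquiv.ofLinearMap (Matrix.toEuclideanLin M) (Matrix.toEuclideanLin M⁻¹)
    (by rw [← Matrix.toLpLin_mul_same, Matrix.mul_nonsing_inv _ hM.isUnit, Matrix.toLpLin_one])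
    (by rw [← Matrix.toLpLin_mul_same, Matrix.nonsing_inv_mul _ hM.isUnit,
      Matrix.toLpLin_one])).toContinuousLinearEquiv

theorem integral_comp_toEuclideanLin (M : Matrix (Fin d) (Fin d) ℝ) (hM : M.det ≠ 0)
    (F : EuclideanSpace ℝ (Fin d) → ℂ) :
    ∫ t, F (Matrix.toEuclideanLin M t) = |M.det|⁻¹ • ∫ t, F t := by
  have hemb : MeasurableEmbedding (Matrix.toEuclideanLin M) :=
    (euclideanEquiv M hM).toHomeomorph.measurableEmbedding
  rw [← hemb.integral_map, map_toEuclideanLin M hM, integral_smul_measure,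
    ENNReal.toReal_ofReal (abs_nonneg _), abs_inv]

theorem fourier_dilationFun (M : Matrix (Fin d) (Fin d) ℝ) (hM : M.det ≠ 0)
    (f : EuclideanSpace ℝ (Fin d) → ℂ) :
    𝓕 (dilationFun M f) = dilationFun M.transpose⁻¹ (𝓕 f) := by
  funext w
  have hphase : ∀ v, phase v w =
      phase (Matrix.toEuclideanLin M v) (Matrix.toEuclideanLin M.transpose⁻¹ w) := fun v => by
    rw [phase, phase, inner_toEuclideanLin_left, toEuclideanLin_mul_apply,
      Matrix.mul_nonsing_inv _ (by simpa using hM), Matrix.toLpLin_one, LinearMap.id_apply]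
  have hsqrt : √|M.det| * |M.det|⁻¹ = √|M.transpose⁻¹.det| := by
    rw [Matrix.det_nonsing_inv, Matrix.det_transpose, Ring.inverse_eq_inv', abs_inv, Real.sqrt_inv,
      ← div_eq_mul_inv, Real.sqrt_div_self]
  calc 𝓕 (dilationFun M f) w
      = ∫ v, (√|M.det| : ℂ) * (phase (Matrix.toEuclideanLin M v)
          (Matrix.toEuclideanLin M.transpose⁻¹ w) • f (Matrix.toEuclideanLin M v)) := by
        refine (Real.fourier_eq _ _).trans (integral_congr_ae (.of_forall fun v => ?_))
        beta_reduce
        rw [← hphase, mul_smul_comm]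
        rfl
    _ = (√|M.det| : ℂ) * (|M.det|⁻¹ • 𝓕 f (Matrix.toEuclideanLin M.transpose⁻¹ w)) := by
        rw [integral_const_mul, integral_comp_toEuclideanLin M hM
          fun v => phase v (Matrix.toEuclideanLin M.transpose⁻¹ w) • f v]
        rfl
    _ = dilationFun M.transpose⁻¹ (𝓕 f) w := by
        rw [Complex.real_smul, ← mul_assoc, ← Complex.ofReal_mul, hsqrt]
        rfl

theorem exists_schwartz_eq_dilationFun (M : Matrix (Fin d) (Fin d) ℝ) (hM : M.det ≠ 0)
    (f : 𝓢(EuclideanSpace ℝ (Fin d), ℂ)) :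
    ∃ g : 𝓢(EuclideanSpace ℝ (Fin d), ℂ), ⇑g = dilationFun M f :=
  ⟨(√|M.det| : ℂ) • SchwartzMap.compCLMOfContinuousLinearEquiv ℂ (euclideanEquiv M hM) f, rfl⟩

theorem fourierL2_unitaryDilation (M : Matrix (Fin d) (Fin d) ℝ) (hM : M.det ≠ 0) (f : L2 d) :
    fourierL2 d (unitaryDilation M hM f) =
      unitaryDilation M.transpose⁻¹ (det_inv_transpose_ne_zero hM) (fourierL2 d f) := by
  have hM' := det_inv_transpose_ne_zero hM
  refine congrFun (eq_of_eq_schwartz (S := fun f => fourierL2 d (unitaryDilation M hM f))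
    (T := fun f => unitaryDilation M.transpose⁻¹ hM' (fourierL2 d f))
    ((fourierL2 d).continuous.comp (unitaryDilation M hM).continuous)
    ((unitaryDilation M.transpose⁻¹ hM').continuous.comp (fourierL2 d).continuous)
    fun f => ?_) f
  obtain ⟨g, hg⟩ := exists_schwartz_eq_dilationFun M hM f
  have hdilate : unitaryDilation M hM (f.toLp 2) = g.toLp 2 := by
    refine Lp.ext ?_
    filter_upwards [coeFn_unitaryDilation M hM (f.toLp 2), g.coeFn_toLp 2,
      dilationFun_congr M hM (f.coeFn_toLp 2)] with t h₁ h₂ h₃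
    rw [h₁, h₂, h₃, hg]
  simp only [hdilate, fourierL2_toLp]
  refine Lp.ext ?_
  filter_upwards [coeFn_unitaryDilation _ hM' ((𝓕 f).toLp 2), (𝓕 g).coeFn_toLp 2,
    dilationFun_congr _ hM' ((𝓕 f).coeFn_toLp 2)] with w h₁ h₂ h₃
  rw [h₁, h₂, h₃, SchwartzMap.fourier_coe, SchwartzMap.fourier_coe, hg, fourier_dilationFun M hM]

end FourierOperators

section Mask

variable {d : ℕ}

theorem inner_latticePoint (n : Fin d → ℤ) (t : EuclideanSpace ℝ (Fin d)) :
    inner ℝ (latticePoint n) t = ∑ i, (n i : ℝ) * t i := by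
  simp [latticePoint, PiLp.inner_apply, mul_comm]

theorem latticePoint_zero : latticePoint (0 : Fin d → ℤ) = 0 := by
  ext i
  simp [latticePoint]

theorem latticePoint_add (m n : Fin d → ℤ) :
    latticePoint (m + n) = latticePoint m + latticePoint n := by
  ext i
  simp [latticePoint]

/-- The filter `m₀` in the frequency variable of Mathlib's Fourier transform:
`mask h w = m₀ (2π w)`. -/
def mask (h : (Fin d → ℤ) →₀ ℂ) (w : EuclideanSpace ℝ (Fin d)) : ℂ :=
  (√2 : ℂ)⁻¹ * ∑ n ∈ h.support, h n * phase (latticePoint n) w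

theorem filterFun_eq_mask (h : (Fin d → ℤ) →₀ ℂ) (t : EuclideanSpace ℝ (Fin d)) :
    filterFun h t = mask h ((2 * Real.pi)⁻¹ • t) := by
  rw [filterFun, mask, one_div, finsum_eq_sum_of_support_subset (s := h.support)]
  · congr! 4 with n
    rw [coe_phase, inner_smul_right, mul_inv_cancel_left₀ (by positivity), inner_latticePoint,
      Complex.ofReal_neg, mul_neg, neg_mul]
  · exact fun n hn => Finsupp.mem_support_iff.mpr (left_ne_zero_of_mul hn)

theorem continuous_mask (h : (Fin d → ℤ) →₀ ℂ) : Continuous (mask h) :=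
  continuous_const.mul (continuous_finsetSum _ fun n _ =>
    continuous_const.mul (continuous_subtype_val.comp (continuous_phase (latticePoint n))))

variable {h : (Fin d → ℤ) →₀ ℂ}

theorem norm_mask_sub_one_le (hsum : ∑ n ∈ h.support, h n = (√2 : ℂ))
    (w : EuclideanSpace ℝ (Fin d)) :
    ‖mask h w - 1‖ ≤
      ‖(√2 : ℂ)⁻¹‖ * (∑ n ∈ h.support, ‖h n‖ * (2 * Real.pi * ‖latticePoint n‖)) * ‖w‖ := by
  have hdiff : mask h w - 1 =
      (√2 : ℂ)⁻¹ * ∑ n ∈ h.support, h n * ((phase (latticePoint n) w : ℂ) - 1) := by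
    simp only [mul_sub, Finset.sum_sub_distrib, mul_one, hsum, mask]
    rw [inv_mul_cancel₀ (by simp)]
  rw [hdiff, norm_mul, mul_assoc, Finset.sum_mul]
  refine mul_le_mul_of_nonneg_left ((norm_sum_le _ _).trans (Finset.sum_le_sum fun n _ => ?_))
    (norm_nonneg _)
  rw [norm_mul, mul_assoc]
  gcongr
  exact norm_phase_sub_one_le _ _

variable {α : (Fin d → ℤ) →+ (Fin d → ℤ)} {χ : AddChar (Fin d → ℤ) ℂ}

theorem IsIndexTwoCharacter.norm_mask_le_one (hχ : IsIndexTwoCharacter α χ)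
    (hh : IsLawtonFilter α h) (w : EuclideanSpace ℝ (Fin d)) : ‖mask h w‖ ≤ 1 := by
  let e : AddChar (Fin d → ℤ) Circle :=
    { toFun n := phase (latticePoint n) w
      map_zero_eq_one' := by rw [latticePoint_zero, phase_zero]
      map_add_eq_mul' m n := by rw [latticePoint_add, phase_add] }
  have hqmf := hχ.quadrature_mirror hh e
  rw [mask, norm_mul, norm_inv, Complex.norm_real, Real.norm_of_nonneg (Real.sqrt_nonneg _),
    inv_mul_le_iff₀ (by positivity), mul_one]
  exact Real.le_sqrt_of_sq_le ((le_add_of_nonneg_right (sq_nonneg _)).trans hqmf.le)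

theorem IsIndexTwoCharacter.isLowPass_mask (hχ : IsIndexTwoCharacter α χ)
    (hh : IsLawtonFilter α h) (hsum : ∑ n ∈ h.support, h n = (√2 : ℂ)) : IsLowPass (mask h) where
  continuous := continuous_mask h
  norm_le_one := hχ.norm_mask_le_one hh
  exists_norm_sub_one_le := ⟨_, by positivity, norm_mask_sub_one_le hsum⟩

end Mask

section FourierSeries

local instance unitAddCircleMeasureSpace : MeasureSpace UnitAddCircle :=
  ⟨AddCircle.haarAddCircle⟩

variable {d : ℕ}

/-- The half-open unit cube centred at the origin, a fundamental domain of `ℤ^d`. -/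
def cube (d : ℕ) : Set (EuclideanSpace ℝ (Fin d)) :=
  {w | ∀ i, w i ∈ Set.Ioc (-1 / 2 : ℝ) (-1 / 2 + 1)}

theorem measurableSet_cube : MeasurableSet (cube d) :=
  (EuclideanSpace.volume_preserving_symm_measurableEquiv_toLp (Fin d)).measurable
    (MeasurableSet.univ_pi' fun _ => measurableSet_Ioc)

theorem ball_subset_cube : Metric.ball (0 : EuclideanSpace ℝ (Fin d)) (1 / 2) ⊆ cube d := by
  intro w hw i
  have hi := (PiLp.norm_apply_le w i).trans_lt (mem_ball_zero_iff.mp hw)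
  rw [Real.norm_eq_abs, abs_lt] at hi
  exact ⟨by linarith [hi.1], by linarith [hi.2]⟩

/-- The representative in the unit cube of a point of the torus. -/
def torusSection (x : UnitAddTorus (Fin d)) : EuclideanSpace ℝ (Fin d) :=
  WithLp.toLp 2 fun i => (AddCircle.equivIoc 1 (-1 / 2 : ℝ) (x i) : ℝ)

theorem measurePreserving_torusSection :
    MeasurePreserving (torusSection (d := d)) volume (volume.restrict (cube d)) :=
  ((PiLp.volume_preserving_toLp (Fin d)).restrict_preimage measurableSet_cube).comp
    ((measurePreserving_subtype_coe (MeasurableSet.univ_pi' fun _ => measurableSet_Ioc)).comp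
      (UnitAddTorus.measurePreserving_equivPiIoc fun _ => (-1 / 2 : ℝ)))

theorem measurableEmbedding_torusSection : MeasurableEmbedding (torusSection (d := d)) :=
  (MeasurableEquiv.toLp 2 (Fin d → ℝ)).measurableEmbedding.comp
    ((MeasurableEmbedding.subtype_coe (MeasurableSet.univ_pi' fun _ => measurableSet_Ioc)).comp
      (UnitAddTorus.measurableEquivPiIoc fun _ => (-1 / 2 : ℝ)).measurableEmbedding)

theorem volume_cube : volume (cube d) = 1 := by
  have : IsProbabilityMeasure (volume : Measure UnitAddCircle) :=
    inferInstanceAs (IsProbabilityMeasure AddCircle.haarAddCircle)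
  have h := measurePreserving_torusSection (d := d).measure_preimage
    MeasurableSet.univ.nullMeasurableSet
  rwa [Set.preimage_univ, measure_univ, Measure.restrict_apply_univ, eq_comm] at h

theorem mFourier_eq_conj_phase (n : Fin d → ℤ) (x : UnitAddTorus (Fin d)) :
    UnitAddTorus.mFourier n x = conj (phase (latticePoint n) (torusSection x) : ℂ) :=
  calc UnitAddTorus.mFourier n x
      = ∏ i, fourier (n i) (torusSection x i : UnitAddCircle) :=
        Fintype.prod_congr _ _ fun i =>
          congrArg (fourier (n i)) (AddCircle.coe_equivIoc (a := -1 / 2)).symm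
    _ = conj (phase (latticePoint n) (torusSection x) : ℂ) := by
        simp only [fourier_coe_apply, ← Complex.exp_sum, coe_phase, inner_latticePoint,
          ← Complex.exp_conj, map_mul, Complex.conj_I, Complex.conj_ofReal]
        push_cast
        simp only [Finset.mul_sum, Finset.sum_neg_distrib, mul_neg, neg_mul, neg_neg]
        congr! 2
        ring

/-- The indicator function of the unit cube, the starting point of the cascade algorithm on the
Fourier side. -/
def cubeIndicator (d : ℕ) : L2 d :=
  indicatorConstLp 2 (measurableSet_cube (d := d)) (by simp [volume_cube]) 1

theorem coeFn_cubeIndicator :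
    cubeIndicator d =ᵐ[volume] (cube d).indicator fun _ => (1 : ℂ) :=
  indicatorConstLp_coeFn

theorem inner_modulation_cubeIndicator (n : Fin d → ℤ) (f : L2 d) :
    inner ℂ (modulation (latticePoint n) (cubeIndicator d)) f =
      ∫ w in cube d, conj (phase (latticePoint n) w : ℂ) * f w := by
  rw [L2.inner_def, ← integral_indicator measurableSet_cube]
  refine integral_congr_ae ?_
  filter_upwards [coeFn_modulation (latticePoint n) (cubeIndicator d),
    coeFn_cubeIndicator (d := d)] with w hmod hcube
  rw [hmod, hcube]
  by_cases hw : w ∈ cube d <;> simp [hw, Circle.smul_def, mul_comm]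

theorem hasSum_inner_modulation_cubeIndicator (f : L2 d) :
    HasSum (fun n : Fin d → ℤ =>
      ‖inner ℂ (modulation (latticePoint n) (cubeIndicator d)) f‖ ^ 2)
      (∫ w in cube d, ‖f w‖ ^ 2) := by
  have hσ := measurePreserving_torusSection (d := d)
  have hF : MemLp (f ∘ torusSection) 2 volume := (Lp.memLp f).restrict (cube d)
    |>.comp_measurePreserving hσ
  have hcoeff (n : Fin d → ℤ) : UnitAddTorus.mFourierCoeff (hF.toLp _) (-n) =
      inner ℂ (modulation (latticePoint n) (cubeIndicator d)) f := by
    rw [inner_modulation_cubeIndicator, ← hσ.integral_comp measurableEmbedding_torusSection]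
    refine integral_congr_ae ?_
    filter_upwards [hF.coeFn_toLp] with x hx
    rw [hx, neg_neg, mFourier_eq_conj_phase, smul_eq_mul, Function.comp_apply]
  have hnorm : ∫ x, ‖hF.toLp _ x‖ ^ 2 = ∫ w in cube d, ‖f w‖ ^ 2 := by
    rw [← hσ.integral_comp measurableEmbedding_torusSection]
    refine integral_congr_ae ?_
    filter_upwards [hF.coeFn_toLp] with x hx
    rw [hx, Function.comp_apply]
  have hparseval := UnitAddTorus.hasSum_sq_mFourierCoeff (hF.toLp _)
  rw [hnorm, ← (Equiv.neg _).hasSum_iff] at hparseval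
  exact hparseval.congr_fun fun n => by rw [Function.comp_apply, Equiv.neg_apply, hcoeff]

end FourierSeries

section Lattice

variable {d : ℕ} {A : Matrix (Fin d) (Fin d) ℤ}

/-- The endomorphism `n ↦ A n` of `ℤ^d`. -/
def latticeHom (A : Matrix (Fin d) (Fin d) ℤ) : (Fin d → ℤ) →+ (Fin d → ℤ) :=
  A.mulVecLin.toAddMonoidHom

/-- The representation of `ℤ^d` on `L²(ℝ^d)` by translations. -/
abbrev latticeTranslation (d : ℕ) (n : Fin d → ℤ) : L2 d →ₗᵢ[ℂ] L2 d :=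
  translation (latticePoint n)

/-- The character `n ↦ (-1)^{q∘n}` of `ℤ^d`. -/
def parity (q : Fin d → ℤ) : AddChar (Fin d → ℤ) ℂ where
  toFun n := (-1) ^ (q ⬝ᵥ n)
  map_zero_eq_one' := by simp
  map_add_eq_mul' m n := by rw [dotProduct_add, zpow_add₀ (by simp)]

theorem isIndexTwoCharacter_parity (hdet : |A.det| = 2) {q : Fin d → ℤ}
    (hq : ∀ x, x ∈ imageLattice A ↔ Even (q ⬝ᵥ x)) :
    IsIndexTwoCharacter (latticeHom A) (parity q) where
  injective := by
    refine Matrix.mulVec_injective_of_det_ne_zero fun hzero => ?_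
    simp [hzero] at hdet
  map_range x hx := ((hq x).mp hx).neg_one_zpow
  map_compl x hx := (Int.not_even_iff_odd.mp (mt (hq x).mpr hx)).neg_one_zpow

theorem IsFiniteLawtonSolution.isLawtonFilter {h : (Fin d → ℤ) →₀ ℂ}
    (hh : IsFiniteLawtonSolution A h) : IsLawtonFilter (latticeHom A) h := by
  have hortho (k) (hk : k ∈ imageLattice A) :
      ∑ n ∈ h.support, h n * conj (h (n + k)) = if k = 0 then 1 else 0 := by
    rw [← hh.orthogonality k hk, finsum_eq_sum_of_support_subset]
    exact fun n hn => Finsupp.mem_support_iff.mpr (left_ne_zero_of_mul hn)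
  exact ⟨by simpa using hortho 0 ⟨0, by simp⟩, fun k hk hk0 => by simpa [hk0] using hortho k hk⟩

theorem IsFiniteLawtonSolution.sum_eq {h : (Fin d → ℤ) →₀ ℂ}
    (hh : IsFiniteLawtonSolution A h) : ∑ n ∈ h.support, h n = (√2 : ℂ) := by
  rw [← hh.normalization, finsum_eq_sum_of_support_subset]
  simp

theorem toEuclideanLin_latticePoint (A : Matrix (Fin d) (Fin d) ℤ) (n : Fin d → ℤ) :
    Matrix.toEuclideanLin (realMat A) (latticePoint n) = latticePoint (latticeHom A n) := by
  ext i
  simp [latticePoint, realMat, latticeHom, Matrix.mulVec, dotProduct]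

theorem ae_comp_sub {p : EuclideanSpace ℝ (Fin d) → Prop} (hp : ∀ᵐ t, p t)
    (x : EuclideanSpace ℝ (Fin d)) : ∀ᵐ t, p (t - x) :=
  (measurePreserving_sub_right volume x).quasiMeasurePreserving.ae hp

theorem ae_comp_toEuclideanLin {p : EuclideanSpace ℝ (Fin d) → Prop} (hp : ∀ᵐ t, p t)
    {M : Matrix (Fin d) (Fin d) ℝ} (hM : M.det ≠ 0) :
    ∀ᵐ t, p (Matrix.toEuclideanLin M t) :=
  (quasiMeasurePreserving_toEuclideanLin M hM).ae hp

theorem isDilationSystem_dilation (hdet : |A.det| = 2) :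
    IsDilationSystem (latticeHom A) (dilation A hdet) (latticeTranslation d) where
  add_apply a b f := by
    refine Lp.ext ?_
    filter_upwards [coeFn_translation (latticePoint (a + b)) f,
      coeFn_translation (latticePoint a) (latticeTranslation d b f),
      ae_comp_sub (coeFn_translation (latticePoint b) f) (latticePoint a)] with t h₁ h₂ h₃
    rw [h₁, h₂, h₃, latticePoint_add, sub_sub]
  comm k f := by
    have hA := det_realMat_ne_zero hdet
    refine Lp.ext ?_
    filter_upwards [coeFn_translation (latticePoint k) (dilation A hdet f),
      ae_comp_sub (coeFn_unitaryDilation _ hA f) (latticePoint k),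
      coeFn_unitaryDilation _ hA (latticeTranslation d (latticeHom A k) f),
      ae_comp_toEuclideanLin (coeFn_translation (latticePoint (latticeHom A k)) f) hA]
      with t h₁ h₂ h₃ h₄
    rw [h₁, dilation, h₂, h₃, dilationFun, dilationFun, h₄, map_sub, toEuclideanLin_latticePoint]

end Lattice

section SquareIntegrable

variable {d : ℕ}

theorem integral_norm_sq_eq (f : L2 d) : ∫ w, ‖f w‖ ^ 2 = ‖f‖ ^ 2 := by
  rw [← inner_self_eq_norm_sq (𝕜 := ℂ) f, L2.inner_def, ← integral_re (L2.integrable_inner f f)]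
  simp only [inner_self_eq_norm_sq]

theorem integrable_norm_sq (f : L2 d) : Integrable fun w => ‖f w‖ ^ 2 :=
  (Lp.memLp f).integrable_norm_pow (by simp)

theorem memLp_of_tendsto_ae {u : ℕ → L2 d} (hu : ∀ k, ‖u k‖ ≤ 1)
    {g : EuclideanSpace ℝ (Fin d) → ℂ}
    (hlim : ∀ᵐ w, Tendsto (fun k => u k w) atTop (𝓝 (g w))) : MemLp g 2 := by
  have hmeas (k : ℕ) : AEStronglyMeasurable (u k) := Lp.aestronglyMeasurable _
  refine ⟨aestronglyMeasurable_of_tendsto_ae atTop hmeas hlim, ?_⟩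
  have hnorm (k : ℕ) : eLpNorm (u k) 2 ≤ 1 := by
    rw [← ENNReal.ofReal_toReal (Lp.eLpNorm_ne_top (u k)), ← Lp.norm_def]
    exact ENNReal.ofReal_le_one.mpr (hu k)
  have hlower : eLpNorm g 2 ≤ liminf (fun k => eLpNorm (u k) 2) atTop :=
    Lp.eLpNorm_lim_le_liminf_eLpNorm hmeas g hlim
  have hliminf := liminf_le_of_frequently_le' (Frequently.of_forall (f := atTop) hnorm)
  exact (hlower.trans hliminf).trans_lt ENNReal.one_lt_top

theorem tendsto_inner_of_tendsto_ae {u : ℕ → L2 d} {v g : L2 d}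
    (hu : ∀ k, ∀ᵐ w, ‖u k w‖ ≤ 1) (hg : Integrable g)
    (hlim : ∀ᵐ w, Tendsto (fun k => u k w) atTop (𝓝 (v w))) :
    Tendsto (fun k => inner ℂ (u k) g) atTop (𝓝 (inner ℂ v g)) := by
  simp only [L2.inner_def]
  refine tendsto_integral_of_dominated_convergence _
    (fun k => (L2.integrable_inner (u k) g).aestronglyMeasurable) hg.norm (fun k => ?_) ?_
  · filter_upwards [hu k] with w hw
    exact (norm_inner_le_norm _ _).trans (mul_le_of_le_one_left (norm_nonneg _) hw)
  · filter_upwards [hlim] with w hw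
    exact hw.inner tendsto_const_nhds

/-- The functions in `L²(ℝ^d)` that vanish almost everywhere outside some ball. -/
def boundedSupport (d : ℕ) : Set (L2 d) :=
  {f | ∃ r : ℝ, ∀ᵐ w, r < ‖w‖ → f w = 0}

theorem dense_boundedSupport : Dense (boundedSupport d) := by
  refine (Lp.dense_hasCompactSupport_contDiff (F := ℂ) (μ := volume)
    (E := EuclideanSpace ℝ (Fin d)) (p := 2) (by simp)).mono ?_
  rintro f ⟨g, hfg, hcompact, -⟩
  obtain ⟨r, hr⟩ := hcompact.isBounded.subset_closedBall 0
  refine ⟨r, ?_⟩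
  filter_upwards [hfg] with w hw hrw
  rw [hw]
  refine image_eq_zero_of_notMem_tsupport fun hmem => hrw.not_ge ?_
  simpa using hr hmem

theorem integrable_of_mem_boundedSupport {f : L2 d} (hf : f ∈ boundedSupport d) :
    Integrable f := by
  obtain ⟨r, hr⟩ := hf
  have hball : IntegrableOn f (Metric.closedBall 0 r) :=
    have : IsFiniteMeasure (volume.restrict (Metric.closedBall (0 : EuclideanSpace ℝ (Fin d)) r)) :=
      isFiniteMeasure_restrict.mpr measure_closedBall_lt_top.ne
    ((Lp.memLp f).restrict _).integrable one_le_two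
  refine hball.integrable_of_ae_notMem_eq_zero ?_
  filter_upwards [hr] with w hw hmem
  exact hw (by simpa using hmem)

end SquareIntegrable

section Cascade

variable {d : ℕ} {A : Matrix (Fin d) (Fin d) ℤ} (hdet : |A.det| = 2)

include hdet in
theorem sqrt_abs_det_inv_transpose : √|(realMat A).transpose⁻¹.det| = (√2)⁻¹ := by
  have hcast : (realMat A).det = (A.det : ℝ) := (Int.cast_det A).symm
  have habs : |(A.det : ℝ)| = 2 := by exact_mod_cast hdet
  rw [Matrix.det_nonsing_inv, Matrix.det_transpose, Ring.inverse_eq_inv', hcast, abs_inv, habs,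
    Real.sqrt_inv]

include hdet in
theorem ae_comp_dualContraction {p : EuclideanSpace ℝ (Fin d) → Prop} (hp : ∀ᵐ w, p w) :
    ∀ᵐ w, p (dualContraction A w) :=
  ae_comp_toEuclideanLin hp (det_inv_transpose_ne_zero (det_realMat_ne_zero hdet))

theorem fourierL2_dilation_latticeTranslation (n : Fin d → ℤ) (φ : L2 d) :
    fourierL2 d (dilation A hdet (latticeTranslation d n φ)) =ᵐ[volume] fun w =>
      (√2 : ℂ)⁻¹ * (phase (latticePoint n) (dualContraction A w) *
        fourierL2 d φ (dualContraction A w)) := by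
  rw [dilation, fourierL2_unitaryDilation, fourierL2_translation]
  filter_upwards [coeFn_unitaryDilation _ (det_inv_transpose_ne_zero (det_realMat_ne_zero hdet))
      (modulation (latticePoint n) (fourierL2 d φ)),
    ae_comp_dualContraction hdet (coeFn_modulation (latticePoint n) (fourierL2 d φ))]
    with w hdil hmod
  rw [hdil, dilationFun, sqrt_abs_det_inv_transpose hdet, Complex.ofReal_inv, ← smul_eq_mul (_ : ℂ)
    (fourierL2 d φ _), ← Circle.smul_def, ← hmod]
  rfl

theorem fourierL2_refinement (h : (Fin d → ℤ) →₀ ℂ) (φ : L2 d) :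
    fourierL2 d (refinement h (dilation A hdet) (latticeTranslation d) φ) =ᵐ[volume] fun w =>
      mask h (dualContraction A w) * fourierL2 d φ (dualContraction A w) := by
  let ψ (n : Fin d → ℤ) : L2 d := fourierL2 d (dilation A hdet (latticeTranslation d n φ))
  have hsum : fourierL2 d (refinement h (dilation A hdet) (latticeTranslation d) φ) =
      ∑ n ∈ h.support, h n • ψ n := by
    simp only [refinement, map_sum, map_smul, ψ]
  have hterm : ∀ᵐ w, ∀ n, (h n • ψ n) w = h n * ((√2 : ℂ)⁻¹ * (phase (latticePoint n)
      (dualContraction A w) * fourierL2 d φ (dualContraction A w))) := by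
    refine ae_all_iff.mpr fun n => ?_
    filter_upwards [Lp.coeFn_smul (h n) (ψ n), fourierL2_dilation_latticeTranslation hdet n φ]
      with w hsmul hψ
    rw [hsmul, Pi.smul_apply, hψ, smul_eq_mul]
  rw [hsum]
  filter_upwards [hterm, Lp.coeFn_finsetSum h.support fun n => h n • ψ n] with w hw hcoe
  rw [hcoe, Finset.sum_apply, Finset.sum_congr rfl fun n _ => hw n, mask, Finset.mul_sum,
    Finset.sum_mul]
  exact Finset.sum_congr rfl fun n _ => by ring

theorem inner_latticeTranslation (φ f : L2 d) (n : Fin d → ℤ) :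
    inner ℂ (latticeTranslation d n φ) f =
      inner ℂ (modulation (latticePoint n) (fourierL2 d φ)) (fourierL2 d f) := by
  rw [← fourierL2_translation, LinearIsometryEquiv.inner_map_map]

theorem isBesselOne_cubeIndicator :
    IsBesselOne fun n => latticeTranslation d n ((fourierL2 d).symm (cubeIndicator d)) := by
  intro f F
  simp only [inner_latticeTranslation, LinearIsometryEquiv.apply_symm_apply]
  calc ∑ n ∈ F, ‖inner ℂ (modulation (latticePoint n) (cubeIndicator d)) (fourierL2 d f)‖ ^ 2
      ≤ ∫ w in cube d, ‖fourierL2 d f w‖ ^ 2 :=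
        sum_le_hasSum F (fun _ _ => sq_nonneg _) (hasSum_inner_modulation_cubeIndicator _)
    _ ≤ ∫ w, ‖fourierL2 d f w‖ ^ 2 :=
        setIntegral_le_integral (integrable_norm_sq _) (.of_forall fun _ => sq_nonneg _)
    _ = ‖f‖ ^ 2 := by rw [integral_norm_sq_eq, LinearIsometryEquiv.norm_map]

/-- The cascade algorithm: the iterates of the refinement operator, starting from the function
whose Fourier transform is the indicator of the unit cube. -/
def cascade (h : (Fin d → ℤ) →₀ ℂ) (k : ℕ) : L2 d :=
  (refinement h (dilation A hdet) (latticeTranslation d))^[k]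
    ((fourierL2 d).symm (cubeIndicator d))

theorem cascade_succ (h : (Fin d → ℤ) →₀ ℂ) (k : ℕ) :
    cascade hdet h (k + 1) =
      refinement h (dilation A hdet) (latticeTranslation d) (cascade hdet h k) :=
  Function.iterate_succ_apply' _ _ _

/-- The Fourier transform of the `k`-th cascade iterate. -/
def cascadeSymbol (A : Matrix (Fin d) (Fin d) ℤ) (h : (Fin d → ℤ) →₀ ℂ) (k : ℕ)
    (w : EuclideanSpace ℝ (Fin d)) : ℂ :=
  (∏ j ∈ Finset.range k, mask h ((dualContraction A ^ (j + 1)) w)) *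
    (cube d).indicator (fun _ => (1 : ℂ)) ((dualContraction A ^ k) w)

theorem cascadeSymbol_succ (A : Matrix (Fin d) (Fin d) ℤ) (h : (Fin d → ℤ) →₀ ℂ) (k : ℕ)
    (w : EuclideanSpace ℝ (Fin d)) :
    cascadeSymbol A h (k + 1) w =
      mask h (dualContraction A w) * cascadeSymbol A h k (dualContraction A w) := by
  simp only [cascadeSymbol, Finset.prod_range_succ', pow_succ (dualContraction A) (_ + 1),
    pow_succ (dualContraction A) k, zero_add, pow_one, mul_apply_eq_comp]
  ring

theorem fourierL2_cascade (h : (Fin d → ℤ) →₀ ℂ) (k : ℕ) :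
    fourierL2 d (cascade hdet h k) =ᵐ[volume] cascadeSymbol A h k := by
  induction k with
  | zero =>
    rw [cascade, Function.iterate_zero, id, LinearIsometryEquiv.apply_symm_apply]
    filter_upwards [coeFn_cubeIndicator (d := d)] with w hw
    simp [hw, cascadeSymbol]
  | succ k ih =>
    rw [cascade_succ]
    filter_upwards [fourierL2_refinement hdet h (cascade hdet h k),
      ae_comp_dualContraction hdet ih] with w hrefine hk
    rw [hrefine, hk, cascadeSymbol_succ]

variable {h : (Fin d → ℤ) →₀ ℂ}

theorem tendsto_pow_apply_zero {E : Type*} [NormedAddCommGroup E] [NormedSpace ℝ E] {B : E →L[ℝ] E}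
    (hB : Summable fun n => ‖B ^ n‖) (w : E) : Tendsto (fun n => (B ^ n) w) atTop (𝓝 0) := by
  refine squeeze_zero_norm (fun n => (B ^ n).le_opNorm w) ?_
  simpa using hB.tendsto_atTop_zero.mul_const ‖w‖

theorem tendsto_cascadeSymbol (hm : IsLowPass (mask h))
    (hB : Summable fun n => ‖dualContraction A ^ n‖) (w : EuclideanSpace ℝ (Fin d)) :
    Tendsto (fun k => cascadeSymbol A h k w) atTop
      (𝓝 (cascadeProduct (dualContraction A) (mask h) w)) := by
  refine (hm.tendsto_prod_range hB w).congr' ?_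
  filter_upwards [(tendsto_pow_apply_zero hB w).eventually
    (Metric.ball_mem_nhds 0 (half_pos one_pos))] with k hk
  rw [cascadeSymbol, Set.indicator_of_mem (ball_subset_cube hk), mul_one]

theorem norm_cascadeSymbol_le_one (hm : IsLowPass (mask h)) (A : Matrix (Fin d) (Fin d) ℤ) (k : ℕ)
    (w : EuclideanSpace ℝ (Fin d)) : ‖cascadeSymbol A h k w‖ ≤ 1 := by
  rw [cascadeSymbol, norm_mul]
  refine mul_le_one₀ (hm.norm_prod_range_le_one _ _ _) (norm_nonneg _) ?_
  exact (norm_indicator_le_norm_self _ _).trans norm_one.le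

theorem isBesselOne_cascade {χ : AddChar (Fin d → ℤ) ℂ}
    (hχ : IsIndexTwoCharacter (latticeHom A) χ) (hh : IsLawtonFilter (latticeHom A) h)
    {ℓ : Fin d → ℤ} (hℓ : ℓ ∉ Set.range (latticeHom A)) (k : ℕ) :
    IsBesselOne fun n => latticeTranslation d n (cascade hdet h k) := by
  induction k with
  | zero => exact isBesselOne_cubeIndicator
  | succ k ih =>
    rw [cascade_succ]
    exact (isDilationSystem_dilation hdet).isBesselOne_refinement hχ hh hℓ ih

include hdet in
theorem memLp_cascadeProduct (hm : IsLowPass (mask h))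
    (hB : Summable fun n => ‖dualContraction A ^ n‖)
    (hbessel : ∀ k, IsBesselOne fun n => latticeTranslation d n (cascade hdet h k)) :
    MemLp (cascadeProduct (dualContraction A) (mask h)) 2 := by
  refine memLp_of_tendsto_ae (u := fun k => fourierL2 d (cascade hdet h k)) (fun k => ?_) ?_
  · rw [LinearIsometryEquiv.norm_map, ← (latticeTranslation d 0).norm_map]
    exact (hbessel k).norm_le_one 0
  · filter_upwards [ae_all_iff.mpr (fourierL2_cascade hdet h)] with w hw
    simpa only [hw] using tendsto_cascadeSymbol hm hB w

variable {φ : L2 d}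
  (hφ : fourierL2 d φ =ᵐ[volume] cascadeProduct (dualContraction A) (mask h))
include hφ

theorem isBesselOne_of_fourierL2_eq (hm : IsLowPass (mask h))
    (hB : Summable fun n => ‖dualContraction A ^ n‖)
    (hbessel : ∀ k, IsBesselOne fun n => latticeTranslation d n (cascade hdet h k)) :
    IsBesselOne fun n => latticeTranslation d n φ := by
  refine IsBesselOne.of_tendsto_inner hbessel (l := atTop)
    (dense_boundedSupport.preimage (fourierL2 d).toHomeomorph.isOpenMap) fun g hg n => ?_
  have hmod : ∀ᵐ w, ∀ k, modulation (latticePoint n) (fourierL2 d (cascade hdet h k)) w =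
      phase (latticePoint n) w • cascadeSymbol A h k w := by
    refine ae_all_iff.mpr fun k => ?_
    filter_upwards [coeFn_modulation (latticePoint n) (fourierL2 d (cascade hdet h k)),
      fourierL2_cascade hdet h k] with w hw hk
    rw [hw, hk]
  simp only [inner_latticeTranslation]
  refine tendsto_inner_of_tendsto_ae (fun k => ?_) (integrable_of_mem_boundedSupport hg) ?_
  · filter_upwards [hmod] with w hw
    rw [hw, Circle.norm_smul]
    exact norm_cascadeSymbol_le_one hm A k w
  · filter_upwards [hmod, coeFn_modulation (latticePoint n) (fourierL2 d φ), hφ] with w hw hφn hφw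
    simp only [hw, hφn, hφw]
    exact (tendsto_cascadeSymbol hm hB w).const_smul _

theorem refinement_eq_self (hm : IsLowPass (mask h))
    (hB : Summable fun n => ‖dualContraction A ^ n‖) :
    refinement h (dilation A hdet) (latticeTranslation d) φ = φ := by
  refine (fourierL2 d).injective (Lp.ext ?_)
  filter_upwards [fourierL2_refinement hdet h φ, ae_comp_dualContraction hdet hφ, hφ]
    with w hrefine hcontract hw
  rw [hrefine, hcontract, hw, ← hm.cascadeProduct_eq_mul hB]

end Cascade

section DilationPowers

variable {d : ℕ}

theorem unitaryDilation_inv (M : Matrix (Fin d) (Fin d) ℝ) (hM : M.det ≠ 0) :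
    (unitaryDilation M hM)⁻¹ =
      unitaryDilation M⁻¹ (by simpa [Matrix.det_nonsing_inv] using hM) := by
  refine LinearIsometryEquiv.ext fun f => ?_
  rfl

theorem dilationFun_dilationFun (M N : Matrix (Fin d) (Fin d) ℝ)
    (f : EuclideanSpace ℝ (Fin d) → ℂ) :
    dilationFun M (dilationFun N f) = dilationFun (N * M) f := by
  funext t
  simp only [dilationFun, toEuclideanLin_mul_apply, Matrix.det_mul, abs_mul]
  rw [← mul_assoc, ← Complex.ofReal_mul, ← Real.sqrt_mul (abs_nonneg _), mul_comm |M.det|]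

variable {M : Matrix (Fin d) (Fin d) ℝ} (hM : M.det ≠ 0)

theorem coeFn_unitaryDilation_pow (n : ℕ) (f : L2 d) :
    (unitaryDilation M hM ^ n) f =ᵐ[volume] dilationFun (M ^ n) f := by
  induction n with
  | zero => exact .of_forall fun t => by simp [dilationFun]
  | succ n ih =>
    rw [pow_succ', LinearIsometryEquiv.coe_mul]
    refine (coeFn_unitaryDilation M hM _).trans ((dilationFun_congr M hM ih).trans ?_)
    rw [dilationFun_dilationFun, ← pow_succ]

include hM in
theorem ae_comp_toEuclideanLin_pow {p : EuclideanSpace ℝ (Fin d) → Prop} (hp : ∀ᵐ t, p t) (n : ℕ) :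
    ∀ᵐ t, p (Matrix.toEuclideanLin (M ^ n) t) :=
  ae_comp_toEuclideanLin hp (by simpa using pow_ne_zero n hM)

include hM in
theorem toEuclideanCLM_inv_pow_apply (n : ℕ) (t : EuclideanSpace ℝ (Fin d)) :
    (Matrix.toEuclideanCLM (𝕜 := ℝ) M⁻¹ ^ n) (Matrix.toEuclideanLin (M ^ n) t) = t := by
  have hinv : M⁻¹ ^ n * M ^ n = 1 := by
    rw [Matrix.inv_pow', Matrix.nonsing_inv_mul]
    simpa using (pow_ne_zero n hM).isUnit
  rw [← map_pow]
  exact (toEuclideanLin_mul_apply _ _ t).trans (by rw [hinv, Matrix.toLpLin_one]; rfl)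

theorem ae_unitaryDilation_pow_eq_zero {f : L2 d} {r : ℝ} (hf : ∀ᵐ t, r < ‖t‖ → f t = 0) (n : ℕ) :
    ∀ᵐ t, ‖Matrix.toEuclideanCLM (𝕜 := ℝ) M⁻¹ ^ n‖ * r < ‖t‖ →
      (unitaryDilation M hM ^ n) f t = 0 := by
  filter_upwards [coeFn_unitaryDilation_pow hM n f, ae_comp_toEuclideanLin_pow hM hf n]
    with t hcoe hzero ht
  rw [hcoe, dilationFun, hzero, mul_zero]
  by_contra! hle
  refine ht.not_ge ?_
  calc ‖t‖ = ‖(Matrix.toEuclideanCLM (𝕜 := ℝ) M⁻¹ ^ n) (Matrix.toEuclideanLin (M ^ n) t)‖ := by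
        rw [toEuclideanCLM_inv_pow_apply hM]
    _ ≤ ‖Matrix.toEuclideanCLM (𝕜 := ℝ) M⁻¹ ^ n‖ * r :=
        ContinuousLinearMap.le_opNorm_of_le _ hle

theorem fourierL2_inv_dilation_pow {A : Matrix (Fin d) (Fin d) ℤ} (hdet : |A.det| = 2) (n : ℕ)
    (f : L2 d) :
    fourierL2 d (((dilation A hdet)⁻¹ ^ n) f) =
      (unitaryDilation (realMat A).transpose (by simpa using det_realMat_ne_zero hdet) ^ n)
        (fourierL2 d f) := by
  have hA : IsUnit (realMat A).transpose.det := by simpa using (det_realMat_ne_zero hdet).isUnit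
  induction n with
  | zero => simp
  | succ n ih =>
    rw [pow_succ', LinearIsometryEquiv.coe_mul, Function.comp_apply, pow_succ',
      LinearIsometryEquiv.coe_mul, Function.comp_apply, ← ih, dilation, unitaryDilation_inv,
      fourierL2_unitaryDilation]
    simp only [Matrix.transpose_nonsing_inv, Matrix.nonsing_inv_nonsing_inv _ hA]

end DilationPowers

section FineScales

variable {d : ℕ}

theorem energy_latticeTranslation {φ g z : L2 d}
    (hz : z =ᵐ[volume] fun w => conj (fourierL2 d φ w) * fourierL2 d g w)
    (hcube : ∀ᵐ w, w ∉ cube d → z w = 0) :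
    energy (fun n => latticeTranslation d n φ) g = ‖z‖ ^ 2 := by
  have hinner (n : Fin d → ℤ) : inner ℂ (latticeTranslation d n φ) g =
      inner ℂ (modulation (latticePoint n) (cubeIndicator d)) z := by
    rw [inner_latticeTranslation, inner_modulation_cubeIndicator, L2.inner_def,
      setIntegral_eq_integral_of_ae_compl_eq_zero]
    · refine integral_congr_ae ?_
      filter_upwards [hz, coeFn_modulation (latticePoint n) (fourierL2 d φ)] with w hzw hmod
      rw [hzw, hmod, RCLike.inner_apply', Circle.smul_def, smul_eq_mul, map_mul, mul_assoc]
    · filter_upwards [hcube] with w hw hmem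
      rw [hw hmem, mul_zero]
  simp only [energy, hinner]
  rw [(hasSum_inner_modulation_cubeIndicator z).tsum_eq, ← integral_norm_sq_eq,
    setIntegral_eq_integral_of_ae_compl_eq_zero]
  filter_upwards [hcube] with w hw hmem
  rw [hw hmem, norm_zero, zero_pow two_ne_zero]

theorem memLp_mul_of_norm_le_one {γ : EuclideanSpace ℝ (Fin d) → ℂ} (hγ : Continuous γ)
    (hle : ∀ w, ‖γ w‖ ≤ 1) (u : L2 d) : MemLp (fun w => γ w * u w) 2 :=
  (Lp.memLp u).of_le (hγ.aestronglyMeasurable.mul (Lp.aestronglyMeasurable u)) <|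
    .of_forall fun w => by
      rw [norm_mul]
      exact mul_le_of_le_one_left (norm_nonneg _) (hle w)

theorem tendsto_norm_sq_mul {γ : ℕ → EuclideanSpace ℝ (Fin d) → ℂ} (hγ : ∀ n, Continuous (γ n))
    (hle : ∀ n w, ‖γ n w‖ ≤ 1) (hlim : ∀ w, Tendsto (fun n => γ n w) atTop (𝓝 1)) (u : L2 d) :
    Tendsto (fun n => ‖(memLp_mul_of_norm_le_one (hγ n) (hle n) u).toLp _‖ ^ 2) atTop
      (𝓝 (‖u‖ ^ 2)) := by
  have hmem (n : ℕ) := memLp_mul_of_norm_le_one (hγ n) (hle n) u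
  have hcoe : ∀ᵐ w, ∀ n, (hmem n).toLp _ w = γ n w * u w :=
    ae_all_iff.mpr fun n => (hmem n).coeFn_toLp
  simp only [← integral_norm_sq_eq]
  refine tendsto_integral_of_dominated_convergence (fun w => ‖u w‖ ^ 2)
    (fun n => (integrable_norm_sq _).aestronglyMeasurable) (integrable_norm_sq u)
    (fun n => ?_) ?_
  · filter_upwards [hcoe] with w hw
    rw [hw, norm_pow, norm_norm, norm_mul]
    gcongr
    exact mul_le_of_le_one_left (norm_nonneg _) (hle n w)
  · filter_upwards [hcoe] with w hw
    simpa only [hw, one_mul] using ((hlim w).mul_const (u w)).norm.pow 2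

variable {A : Matrix (Fin d) (Fin d) ℤ} (hdet : |A.det| = 2)

/-- Both sides are the norm of `conj Γ` times the Fourier transform of the dilate of `f`, computed
before and after rescaling. -/
theorem energy_inv_dilation_pow {φ f : L2 d} {Γ : EuclideanSpace ℝ (Fin d) → ℂ}
    (hφ : fourierL2 d φ =ᵐ[volume] Γ) {n : ℕ}
    (hf : ∀ᵐ w, w ∉ cube d → fourierL2 d (((dilation A hdet)⁻¹ ^ n) f) w = 0)
    (hy : MemLp (fun w => conj (Γ ((dualContraction A ^ n) w)) * fourierL2 d f w) 2) :
    energy (fun k => latticeTranslation d k φ) (((dilation A hdet)⁻¹ ^ n) f) = ‖hy.toLp _‖ ^ 2 := by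
  have hA : (realMat A).transpose.det ≠ 0 := by simpa using det_realMat_ne_zero hdet
  set U := unitaryDilation (realMat A).transpose hA
  have hz : (U ^ n) (hy.toLp _) =ᵐ[volume] fun w =>
      conj (fourierL2 d φ w) * fourierL2 d (((dilation A hdet)⁻¹ ^ n) f) w := by
    rw [fourierL2_inv_dilation_pow]
    filter_upwards [hφ, coeFn_unitaryDilation_pow hA n (hy.toLp _),
      coeFn_unitaryDilation_pow hA n (fourierL2 d f),
      ae_comp_toEuclideanLin_pow hA hy.coeFn_toLp n] with w hφw hU hUf hcoe
    rw [hU, hUf, dilationFun, hcoe, hφw, dilationFun, dualContraction,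
      toEuclideanCLM_inv_pow_apply hA, mul_left_comm]
  rw [energy_latticeTranslation hz, LinearIsometryEquiv.norm_map]
  filter_upwards [hz, hf] with w hzw hfw hmem
  rw [hzw, hfw hmem, mul_zero]

theorem tendsto_energy_fine {φ f : L2 d} {Γ : EuclideanSpace ℝ (Fin d) → ℂ}
    (hφ : fourierL2 d φ =ᵐ[volume] Γ) (hΓ : Continuous Γ) (hle : ∀ w, ‖Γ w‖ ≤ 1) (hΓ0 : Γ 0 = 1)
    (hB : Summable fun n => ‖dualContraction A ^ n‖) (hf : fourierL2 d f ∈ boundedSupport d) :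
    Tendsto (fun n : ℕ => energy (fun k => latticeTranslation d k φ)
      (((dilation A hdet)⁻¹ ^ n) f)) atTop (𝓝 (‖f‖ ^ 2)) := by
  have hA : (realMat A).transpose.det ≠ 0 := by simpa using det_realMat_ne_zero hdet
  obtain ⟨r, hr⟩ := hf
  have hsupport : ∀ᶠ n in atTop, ∀ᵐ w, w ∉ cube d →
      fourierL2 d (((dilation A hdet)⁻¹ ^ n) f) w = 0 := by
    have hradius : Tendsto (fun n => ‖dualContraction A ^ n‖ * r) atTop (𝓝 0) := by
      simpa using hB.tendsto_atTop_zero.mul_const r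
    filter_upwards [hradius.eventually_lt_const (half_pos one_pos)] with n hn
    rw [fourierL2_inv_dilation_pow]
    filter_upwards [ae_unitaryDilation_pow_eq_zero hA hr n] with w hw hmem
    refine hw (hn.trans_le ?_)
    by_contra! hlt
    exact hmem (ball_subset_cube (mem_ball_zero_iff.mpr hlt))
  have hγ (n : ℕ) : Continuous fun w => conj (Γ ((dualContraction A ^ n) w)) := by fun_prop
  have hγle (n : ℕ) (w) : ‖conj (Γ ((dualContraction A ^ n) w))‖ ≤ 1 := by
    rw [RCLike.norm_conj]
    exact hle _
  have hγlim (w) : Tendsto (fun n => conj (Γ ((dualContraction A ^ n) w))) atTop (𝓝 1) := by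
    have hcont : Continuous fun v => conj (Γ v) := by fun_prop
    have hlim := (hcont.tendsto 0).comp (tendsto_pow_apply_zero hB w)
    rwa [hΓ0, map_one] at hlim
  have hnorm := tendsto_norm_sq_mul hγ hγle hγlim (fourierL2 d f)
  rw [LinearIsometryEquiv.norm_map] at hnorm
  refine hnorm.congr' ?_
  filter_upwards [hsupport] with n hn
  rw [energy_inv_dilation_pow hdet hφ hn]

end FineScales

section CoarseScales

variable {d : ℕ}

theorem norm_inner_sq_le_setIntegral_mul {s : Set (EuclideanSpace ℝ (Fin d))}
    (hs : MeasurableSet s) {g : L2 d} (hg : ∀ᵐ t, t ∉ s → g t = 0) (ψ : L2 d) :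
    ‖inner ℂ ψ g‖ ^ 2 ≤ (∫ t in s, ‖ψ t‖ ^ 2) * ‖g‖ ^ 2 := by
  have hmem := (Lp.memLp ψ).indicator hs
  have hinner : inner ℂ ψ g = inner ℂ (hmem.toLp _) g := by
    rw [L2.inner_def, L2.inner_def]
    refine integral_congr_ae ?_
    filter_upwards [hmem.coeFn_toLp, hg] with t hcoe ht
    rw [hcoe]
    by_cases hts : t ∈ s
    · rw [Set.indicator_of_mem hts]
    · rw [ht hts, inner_zero_right, inner_zero_right]
  have hnorm : ‖hmem.toLp _‖ ^ 2 = ∫ t in s, ‖ψ t‖ ^ 2 := by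
    rw [← integral_norm_sq_eq, ← integral_indicator hs]
    refine integral_congr_ae ?_
    filter_upwards [hmem.coeFn_toLp] with t hcoe
    rw [hcoe]
    by_cases hts : t ∈ s <;> simp [hts]
  rw [hinner, ← hnorm, ← mul_pow]
  gcongr
  exact norm_inner_le_norm _ _

theorem setIntegral_ball_latticeTranslation (n : Fin d → ℤ) (φ : L2 d) (r : ℝ) :
    ∫ t in Metric.ball 0 r, ‖latticeTranslation d n φ t‖ ^ 2 =
      ∫ t in Metric.ball (-latticePoint n) r, ‖φ t‖ ^ 2 := by
  have hshift := measurePreserving_sub_right (volume : Measure (EuclideanSpace ℝ (Fin d)))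
    (latticePoint n)
  have hball : (· - latticePoint n) ⁻¹' Metric.ball (-latticePoint n) r = Metric.ball 0 r := by
    ext t
    simp [dist_eq_norm]
  rw [← hshift.setIntegral_preimage_emb (measurableEmbedding_subRight _) fun t => ‖φ t‖ ^ 2, hball]
  refine integral_congr_ae (ae_restrict_of_ae ?_)
  filter_upwards [coeFn_translation (latticePoint n) φ] with t ht
  rw [ht]

theorem one_le_dist_latticePoint {m n : Fin d → ℤ} (hmn : m ≠ n) :
    1 ≤ dist (latticePoint m) (latticePoint n) := by
  obtain ⟨i, hi⟩ := Function.ne_iff.mp hmn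
  calc (1 : ℝ) ≤ |((m i - n i : ℤ) : ℝ)| := by
        exact_mod_cast Int.one_le_abs (sub_ne_zero.mpr hi)
    _ = ‖(latticePoint m - latticePoint n) i‖ := by simp [latticePoint]
    _ ≤ dist (latticePoint m) (latticePoint n) := by
        rw [dist_eq_norm]
        exact PiLp.norm_apply_le _ i

theorem summable_setIntegral_ball_latticeTranslation (φ : L2 d) :
    Summable fun n : Fin d → ℤ =>
      ∫ t in Metric.ball 0 (1 / 2), ‖latticeTranslation d n φ t‖ ^ 2 := by
  simp only [setIntegral_ball_latticeTranslation]
  refine (hasSum_integral_iUnion (fun _ => measurableSet_ball) (fun m n hmn => ?_)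
    (integrable_norm_sq φ).integrableOn).summable
  refine Metric.ball_disjoint_ball ?_
  rw [dist_neg_neg, add_halves]
  exact one_le_dist_latticePoint hmn

variable [Nontrivial (EuclideanSpace ℝ (Fin d))] {u : ℕ → L2 d} {c : ℝ} (hu : ∀ n, ‖u n‖ ≤ c)
  {ρ : ℕ → ℝ} (hρ : Tendsto ρ atTop (𝓝 0)) (hsupport : ∀ n, ∀ᵐ t, ρ n < ‖t‖ → u n t = 0)
include hu hρ hsupport

theorem tendsto_inner_of_shrinking_support (ψ : L2 d) :
    Tendsto (fun n => inner ℂ ψ (u n)) atTop (𝓝 0) := by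
  let s (n : ℕ) : Set (EuclideanSpace ℝ (Fin d)) := Metric.cthickening (ρ n) {0}
  have hvolume : Tendsto (fun n => volume (s n)) atTop (𝓝 0) := by
    have hcompact := tendsto_measure_cthickening_of_isCompact (μ := volume)
      (isCompact_singleton (x := (0 : EuclideanSpace ℝ (Fin d))))
    rw [measure_singleton] at hcompact
    exact hcompact.comp hρ
  have hlim : Tendsto (fun n => (∫ t in s n, ‖ψ t‖ ^ 2) * c ^ 2) atTop (𝓝 0) := by
    simpa using ((integrable_norm_sq ψ).tendsto_setIntegral_nhds_zero hvolume).mul_const (c ^ 2)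
  have hle (n : ℕ) : ‖inner ℂ ψ (u n)‖ ^ 2 ≤ (∫ t in s n, ‖ψ t‖ ^ 2) * c ^ 2 := by
    have hzero : ∀ᵐ t, t ∉ s n → u n t = 0 := by
      filter_upwards [hsupport n] with t ht hmem
      refine ht (lt_of_not_ge fun hle => hmem ?_)
      exact Metric.closedBall_subset_cthickening (Set.mem_singleton 0) _
        (mem_closedBall_zero_iff.mpr hle)
    refine (norm_inner_sq_le_setIntegral_mul Metric.isClosed_cthickening.measurableSet
      hzero ψ).trans ?_
    gcongr
    exact hu n
  have hsq := squeeze_zero (fun _ => sq_nonneg _) hle hlim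
  refine tendsto_zero_iff_norm_tendsto_zero.mpr ?_
  simpa only [Real.sqrt_sq (norm_nonneg _), Real.sqrt_zero] using hsq.sqrt

theorem tendsto_energy_of_shrinking_support (φ : L2 d) :
    Tendsto (fun n => energy (fun k => latticeTranslation d k φ) (u n)) atTop (𝓝 0) := by
  have hbound : ∀ᶠ n in atTop, ∀ k, ‖‖inner ℂ (latticeTranslation d k φ) (u n)‖ ^ 2‖ ≤
      (∫ t in Metric.ball 0 (1 / 2), ‖latticeTranslation d k φ t‖ ^ 2) * c ^ 2 := by
    filter_upwards [hρ.eventually_lt_const (half_pos one_pos)] with n hn k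
    have hball : ∀ᵐ t, t ∉ Metric.ball (0 : EuclideanSpace ℝ (Fin d)) (1 / 2) → u n t = 0 := by
      filter_upwards [hsupport n] with t ht hmem
      exact ht (hn.trans_le (by simpa using hmem))
    rw [norm_pow, norm_norm]
    refine (norm_inner_sq_le_setIntegral_mul measurableSet_ball hball _).trans ?_
    gcongr
    exact hu n
  have hterm (k : Fin d → ℤ) :
      Tendsto (fun n => ‖inner ℂ (latticeTranslation d k φ) (u n)‖ ^ 2) atTop (𝓝 0) := by
    simpa using (tendsto_inner_of_shrinking_support hu hρ hsupport _).norm.pow 2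
  simpa only [energy, tsum_zero] using tendsto_tsum_of_dominated_convergence
    ((summable_setIntegral_ball_latticeTranslation φ).mul_right _) hterm hbound

omit hu hρ hsupport in
theorem tendsto_energy_coarse {A : Matrix (Fin d) (Fin d) ℤ} (hdet : |A.det| = 2)
    (hexp : IsExpansive A) (φ : L2 d) {f : L2 d} (hf : f ∈ boundedSupport d) :
    Tendsto (fun n : ℕ => energy (fun k => latticeTranslation d k φ) ((dilation A hdet ^ n) f))
      atTop (𝓝 0) := by
  obtain ⟨r, hr⟩ := hf
  refine tendsto_energy_of_shrinking_support (fun n => (LinearIsometryEquiv.norm_map _ f).le) ?_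
    (ae_unitaryDilation_pow_eq_zero (det_realMat_ne_zero hdet) hr) φ
  have hnorm : Tendsto (fun n => ‖Matrix.toEuclideanCLM (𝕜 := ℝ) (realMat A)⁻¹ ^ n‖) atTop
      (𝓝 0) := by
    simpa only [← map_pow, Matrix.l2_opNorm_toEuclideanCLM] using
      (hexp.summable_norm_inv_pow hdet).tendsto_atTop_zero
  simpa using hnorm.mul_const r

end CoarseScales

section Main

variable {d : ℕ}

theorem toEuclideanLin_smul_one (c : ℝ) (ξ : EuclideanSpace ℝ (Fin d)) :
    Matrix.toEuclideanLin (c • (1 : Matrix (Fin d) (Fin d) ℝ)) ξ = c • ξ := by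
  rw [map_smul, Matrix.toLpLin_one, LinearMap.smul_apply, LinearMap.id_apply]

theorem sqrt_abs_det_scaling (d : ℕ) :
    √|(((2 * Real.pi)⁻¹ : ℝ) • (1 : Matrix (Fin d) (Fin d) ℝ)).det| =
      (2 * Real.pi) ^ (-(d : ℝ) / 2) := by
  have hpi : 0 ≤ 2 * Real.pi := by positivity
  rw [Matrix.det_smul, Matrix.det_one, mul_one, Fintype.card_fin, abs_of_pos (by positivity),
    Real.sqrt_eq_rpow, inv_pow, ← Real.rpow_natCast, ← Real.rpow_neg hpi, ← Real.rpow_mul hpi,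
    mul_one_div]

variable (A : Matrix (Fin d) (Fin d) ℤ) (h : (Fin d → ℤ) →₀ ℂ)

theorem productFactor_eq_mask (ξ : EuclideanSpace ℝ (Fin d)) (j : ℕ) :
    productFactor A h ξ j = mask h ((dualContraction A ^ (j + 1)) ((2 * Real.pi)⁻¹ • ξ)) := by
  rw [productFactor, filterFun_eq_mask, map_smul, dualContraction_pow_apply]

theorem scalingSymbol_eq_dilationFun :
    scalingSymbol A h = dilationFun (((2 * Real.pi)⁻¹ : ℝ) • 1)
      (cascadeProduct (dualContraction A) (mask h)) := by
  funext ξ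
  simp only [scalingSymbol, dilationFun, sqrt_abs_det_scaling, toEuclideanLin_smul_one,
    cascadeProduct, productFactor_eq_mask]

variable {A h}

theorem memLp_scalingSymbol (hΓ : MemLp (cascadeProduct (dualContraction A) (mask h)) 2) :
    MemLp (scalingSymbol A h) 2 := by
  rw [scalingSymbol_eq_dilationFun]
  exact memLp_dilationFun _ (det_scaling_ne_zero d) hΓ

theorem fourierL2_scalingFunction
    (hΓ : MemLp (cascadeProduct (dualContraction A) (mask h)) 2)
    (hg : MemLp (scalingSymbol A h) 2) :
    fourierL2 d (scalingFunction A h hg) =ᵐ[volume]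
      cascadeProduct (dualContraction A) (mask h) := by
  have hsymm : scalingFunction A h hg = (fourierL2 d).symm (hΓ.toLp _) := by
    refine (fourierPlancherel d).injective ?_
    rw [scalingFunction, LinearIsometryEquiv.apply_symm_apply, fourierPlancherel,
      LinearIsometryEquiv.trans_apply, LinearIsometryEquiv.apply_symm_apply]
    refine Lp.ext (hg.coeFn_toLp.trans ?_)
    rw [scalingSymbol_eq_dilationFun]
    exact ((coeFn_unitaryDilation _ (det_scaling_ne_zero d) _).trans
      (dilationFun_congr _ (det_scaling_ne_zero d) hΓ.coeFn_toLp)).symm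
  rw [hsymm, LinearIsometryEquiv.apply_symm_apply]
  exact hΓ.coeFn_toLp

variable (hdet : |A.det| = 2)

theorem waveletOf_eq_detail (ℓ q : Fin d → ℤ) (φ : L2 d) :
    waveletOf A hdet ℓ q h φ =
      detail h (parity q) ℓ (dilation A hdet) (latticeTranslation d) φ := by
  rw [waveletOf, detail, ← finsum_comp_equiv (Equiv.subLeft ℓ),
    finsum_eq_sum_of_support_subset (s := h.support)]
  · simp only [Equiv.subLeft_apply, sub_sub_cancel, parity, AddChar.coe_mk]
  · intro n hn
    by_contra hzero
    refine hn ?_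
    simp [Finsupp.notMem_support_iff.mp hzero]

include hdet in
theorem nontrivial_euclideanSpace : Nontrivial (EuclideanSpace ℝ (Fin d)) := by
  rcases d with _ | d
  · simp at hdet
  · exact (WithLp.equiv 2 (Fin (d + 1) → ℝ)).nontrivial

theorem isParsevalFrameWavelet_waveletOf (hexp : IsExpansive A) {ℓ q : Fin d → ℤ}
    (hχ : IsIndexTwoCharacter (latticeHom A) (parity q)) (hh : IsLawtonFilter (latticeHom A) h)
    (hℓ : ℓ ∉ Set.range (latticeHom A)) (hm : IsLowPass (mask h)) {φ : L2 d}
    (hφ : fourierL2 d φ =ᵐ[volume] cascadeProduct (dualContraction A) (mask h)) :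
    IsParsevalFrameWavelet A hdet (waveletOf A hdet ℓ q h φ) := by
  have := nontrivial_euclideanSpace hdet
  have hB := hexp.summable_norm_dualContraction_pow hdet
  have hbessel : IsBesselOne fun n => latticeTranslation d n φ :=
    isBesselOne_of_fourierL2_eq hdet hφ hm hB (isBesselOne_cascade hdet hχ hh hℓ)
  intro f
  have hfine := hbessel.tendsto_energy_of_dense
    (fun n : ℕ => ((dilation A hdet)⁻¹ ^ n).toLinearIsometry) (continuous_norm.pow 2)
    (dense_boundedSupport.preimage (fourierL2 d).toHomeomorph.isOpenMap)
    (fun g hg => tendsto_energy_fine hdet hφ (hm.continuous_cascadeProduct hB)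
      (hm.norm_cascadeProduct_le_one hB) hm.cascadeProduct_zero hB hg) f
  have hcoarse := hbessel.tendsto_energy_of_dense
    (fun n : ℕ => (dilation A hdet ^ n).toLinearIsometry) (continuous_const (y := (0 : ℝ)))
    dense_boundedSupport (fun g hg => tendsto_energy_coarse hdet hexp φ hg) f
  rw [waveletOf_eq_detail]
  refine (isDilationSystem_dilation hdet).hasSum_wavelet_coefficients hχ hh hℓ hbessel
    (refinement_eq_self hdet hφ hm hB) ?_ ?_
  · rw [← Nat.map_cast_int_atTop, tendsto_map'_iff]
    simpa only [Function.comp_def, zpow_neg, zpow_natCast, ← inv_pow] using! hfine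
  · rw [← map_neg_atTop, ← Nat.map_cast_int_atTop, map_map, tendsto_map'_iff]
    simpa only [Function.comp_def, neg_neg, zpow_natCast] using! hcoarse

theorem PartitionProperties.mem_imageLattice_iff {ℓ q : Fin d → ℤ}
    (hA : PartitionProperties A ℓ q) (x : Fin d → ℤ) :
    x ∈ imageLattice A ↔ Even (q ⬝ᵥ x) := by
  refine ⟨hA.even_dot x, fun heven => ?_⟩
  have hx : x ∈ (fun x => ℓ + x) '' imageLattice A ∪ imageLattice A := hA.union_eq ▸ Set.mem_univ x
  exact hx.resolve_left fun hcoset => Int.not_even_iff_odd.mpr (hA.odd_dot x hcoset) heven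

theorem PartitionProperties.notMem_imageLattice {ℓ q : Fin d → ℤ}
    (hA : PartitionProperties A ℓ q) : ℓ ∉ imageLattice A :=
  Set.disjoint_left.mp hA.disjoint ⟨0, ⟨0, A.mulVec_zero⟩, add_zero ℓ⟩

end Main

end Wavelet

end

theorem theorem8p1_general (d : ℕ) (A : Matrix (Fin d) (Fin d) ℤ) (hdet : |A.det| = 2)
    (hexp : Wavelet.IsExpansive A) (ℓ q : Fin d → ℤ) (hℓ : ℓ ∉ Wavelet.imageLattice A)
    (hq : ∀ x, x ∈ Wavelet.imageLattice A ↔ Even (q ⬝ᵥ x))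
    (h : (Fin d → ℤ) → ℂ) (hh : Wavelet.IsFiniteLawtonSolution A h) :
    (∀ ξ : EuclideanSpace ℝ (Fin d), Multipliable (Wavelet.productFactor A h ξ)) ∧
    ∃ hg : MeasureTheory.MemLp (Wavelet.scalingSymbol A h) 2 MeasureTheory.volume,
      Wavelet.IsParsevalFrameWavelet A hdet
        (Wavelet.waveletOf A hdet ℓ q h (Wavelet.scalingFunction A h hg)) := by
  lift h to (Fin d → ℤ) →₀ ℂ using hh.finite_support
  have hχ := Wavelet.isIndexTwoCharacter_parity hdet hq
  have hlawton := hh.isLawtonFilter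
  have hm := hχ.isLowPass_mask hlawton hh.sum_eq
  have hB := hexp.summable_norm_dualContraction_pow hdet
  have hΓ := Wavelet.memLp_cascadeProduct hdet hm hB
    (Wavelet.isBesselOne_cascade hdet hχ hlawton hℓ)
  have hg := Wavelet.memLp_scalingSymbol hΓ
  refine ⟨fun ξ => ?_, hg, ?_⟩
  · exact (hm.multipliable hB _).congr fun j => (Wavelet.productFactor_eq_mask A h ξ j).symm
  · exact Wavelet.isParsevalFrameWavelet_waveletOf hdet hexp hχ hlawton hℓ hm
      (Wavelet.fourierL2_scalingFunction hΓ hg)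

theorem theorem8p1 (d : ℕ) (A : Matrix (Fin d) (Fin d) ℤ) (hdet : |A.det| = 2)
    (hexp : Wavelet.IsExpansive A) (ℓ q : Fin d → ℤ)
    (hA : Wavelet.PartitionProperties A ℓ q)
    (h : (Fin d → ℤ) → ℂ) (hh : Wavelet.IsFiniteLawtonSolution A h) :
    (∀ ξ : EuclideanSpace ℝ (Fin d), Multipliable (Wavelet.productFactor A h ξ)) ∧
    ∃ hg : MeasureTheory.MemLp (Wavelet.scalingSymbol A h) 2 MeasureTheory.volume,
      Wavelet.IsParsevalFrameWavelet A hdet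
        (Wavelet.waveletOf A hdet ℓ q h (Wavelet.scalingFunction A h hg)) := by
  exact theorem8p1_general d A hdet hexp ℓ q hA.notMem_imageLattice hA.mem_imageLattice_iff h hh
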